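/- Let $A=(A_{x,y})_{x,y\in\mathbb Z}$ be a conservative generator, i.e. $A_{x,y}\ge 0$ for $x\ne y$ and $\sum_{y}A_{x,y}=0$ for every $x$, and assume that $A$ is tridiagonal: $A_{x,y}=0$ whenever $|x-y|\ge 2$. Let $B=([1-\delta_{x,y}]A_{x,y})_{x,y\in\mathbb Z}$ be its off-diagonal part and put $$g_{x,y}(t)=\int_{0}^{2\pi} e^{t\,(B_{x,y}e^{i\theta}+B_{y,x}e^{-i\theta})}\,\frac{d\theta}{2\pi}.$$ For a finite set $R\subset\mathbb Z$, $a,b\in R$ and $l\in(0,\infty)^R$ let $$\rho^{(R)}_{ab}(l)=\det\nolimits^{(R)}_{ab}(-A+\partial_l)\int_{[0,2\pi]^R} e^{\sum_{x,y\in R}A_{x,y}\sqrt{l_x}\sqrt{l_y}\,e^{i(\theta_x-\theta_y)}}\prod_{x\in R}\frac{d\theta_x}{2\pi}$$ (the density, on the event that the range up to time $T$ is $R$ and the endpoint is $b$, of the local times at time $T=\sum_{x\in R} l_x$ of the Markov chain with generator $A$ started at $a$). Here $\partial_l$ is the diagonal matrix with entries $\partial_{l_x}$, and $\det^{(R)}_{ab}(M)$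 is the determinant of the matrix $(1_{x\ne b}M_{x,y}1_{y\ne a}+1_{x=b,\,y=a})_{x,y\in R}$. Let $R\subset\mathbb Z$ be a finite interval and let $a,b\in R$ with $a\le b$. Then, for every $l\in(0,\infty)^R$, $$\rho^{(R)}_{ab}(l)=e^{\sum_{x\in R}A_{x,x}l_x}\Big[\prod_{x\in R,\;x<a}\partial_{l_x}g_{x,x+1}\big(\sqrt{l_xl_{x+1}}\big)\Big]\Big[\prod_{a\le x<b}B_{x,x+1}\,g_{x,x+1}\big(\sqrt{l_xl_{x+1}}\big)\Big]\Big[\prod_{y\in R,\;y>b}\partial_{l_y}g_{y-1,y}\big(\sqrt{l_{y-1}l_y}\big)\Big],$$ where empty products equal $1$. -/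

import Mathlib

namespace LocalTimes

noncomputable section

/-- A conservative generator (Q-matrix) on `Λ`: nonnegative off-diagonal entries, and every row
is summable with sum zero. -/
structure IsConservativeGenerator {Λ : Type*} (A : Matrix Λ Λ ℝ) : Prop where
  offDiag_nonneg : ∀ x y, x ≠ y → 0 ≤ A x y
  row_sum : ∀ x, HasSum (fun y => A x y) 0

/-- A matrix indexed by `ℤ` is tridiagonal if `A x y = 0` whenever `|x - y| ≥ 2`. -/
def IsTridiagonal (A : Matrix ℤ ℤ ℝ) : Prop :=
  ∀ x y : ℤ, 2 ≤ |x - y| → A x y = 0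

/-- The off-diagonal part `B` of `A`. -/
def offDiagPart {Λ : Type*} [DecidableEq Λ] (A : Matrix Λ Λ ℝ) : Matrix Λ Λ ℝ :=
  Matrix.of fun x y => if x = y then 0 else A x y

/-- The `(b, a)` cofactor of `M`: the determinant of the matrix
`(1_{x ≠ b} M_{x,y} 1_{y ≠ a} + 1_{x = b, y = a})_{x,y}`. -/
def cofactorDet {ι K : Type*} [Fintype ι] [DecidableEq ι] [CommRing K] (a b : ι)
    (M : Matrix ι ι K) : K :=
  Matrix.det (Matrix.of fun x y =>
    (if x ≠ b then 1 else 0) * M x y * (if y ≠ a then 1 else 0)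
      + (if x = b ∧ y = a then 1 else 0))

/-- The partial derivative `∂_{l_x} F` at `l`. -/
def partialDeriv {ι : Type*} [DecidableEq ι] (x : ι) (F : (ι → ℝ) → ℂ) : (ι → ℝ) → ℂ :=
  fun l => deriv (fun t : ℝ => F (Function.update l x t)) (l x)

/-- The iterated partial derivative `∏_x ∂_{l_x}^{m x} F`. The derivatives are taken in the order
of the index set; for smooth functions the order is irrelevant. -/
def iteratedPartial {ι : Type*} [Fintype ι] [LinearOrder ι] (m : ι →₀ ℕ) (F : (ι → ℝ) → ℂ) :
    (ι → ℝ) → ℂ :=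
  (Finset.univ.sort (fun x y : ι => x ≤ y)).foldr (fun x G => (partialDeriv x)^[m x] G) F

/-- The constant-coefficient differential operator `p(∂_l)` attached to a polynomial `p` in
variables `X_x`, obtained by substituting `∂_{l_x}` for `X_x`. -/
def diffOp {ι : Type*} [Fintype ι] [LinearOrder ι] (p : MvPolynomial ι ℂ) (F : (ι → ℝ) → ℂ) :
    (ι → ℝ) → ℂ :=
  fun l => ∑ m ∈ p.support, p.coeff m * iteratedPartial m F l

/-- The polynomial whose associated differential operator is `det_{ab}^{(R)}(-A + ∂_l)`: the
cofactor of the `R × R` matrix with entries `-A_{x,y} + δ_{x,y} X_x`. -/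
def cofactorSymbol {Λ : Type*} [LinearOrder Λ] (A : Matrix Λ Λ ℝ) (R : Finset Λ) (a b : R) :
    MvPolynomial R ℂ :=
  cofactorDet a b (Matrix.of fun x y : R =>
    -(MvPolynomial.C ((A x y : ℝ) : ℂ)) + if x = y then MvPolynomial.X x else 0)

/-- `∫_{[0,2π]^R} exp(∑_{x,y ∈ R} A_{x,y} √l_x √l_y e^{i(θ_x - θ_y)}) ∏_{x ∈ R} dθ_x / 2π`. -/
def thetaIntegral {Λ : Type*} (A : Matrix Λ Λ ℝ) (R : Finset Λ) (l : R → ℝ) : ℂ :=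
  ∫ θ in Set.Icc (fun _ : R => (0 : ℝ)) (fun _ : R => 2 * Real.pi),
    Complex.exp (∑ x : R, ∑ y : R,
      (A x y : ℂ) * (Real.sqrt (l x) : ℂ) * (Real.sqrt (l y) : ℂ)
        * Complex.exp (Complex.I * ((θ x : ℂ) - (θ y : ℂ))))
      * ∏ _x : R, (1 / (2 * (Real.pi : ℂ)))

/-- The local-time density
`ρ_{ab}^{(R)}(l) = det_{ab}^{(R)}(-A + ∂_l) ∫ exp(∑ A_{x,y} √l_x √l_y e^{i(θ_x - θ_y)}) ∏ dθ_x/2π`,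
for `l ∈ (0, ∞)^R`. -/
def localTimeDensity {Λ : Type*} [LinearOrder Λ] (A : Matrix Λ Λ ℝ) (R : Finset Λ) (a b : R)
    (l : R → ℝ) : ℂ :=
  diffOp (cofactorSymbol A R a b) (thetaIntegral A R) l

/-- `g_{x,y}(t) = ∫_0^{2π} exp(t (B_{x,y} e^{iθ} + B_{y,x} e^{-iθ})) dθ / 2π`, where `B` is the
off-diagonal part of `A`. -/
def gFun {Λ : Type*} [DecidableEq Λ] (A : Matrix Λ Λ ℝ) (x y : Λ) (t : ℝ) : ℂ :=
  ∫ θ in (0 : ℝ)..(2 * Real.pi),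
    Complex.exp ((t : ℂ) * ((offDiagPart A x y : ℂ) * Complex.exp (Complex.I * (θ : ℂ))
      + (offDiagPart A y x : ℂ) * Complex.exp (-(Complex.I * (θ : ℂ)))))
      * (1 / (2 * (Real.pi : ℂ)))

end

end LocalTimes

/-! Write `p = A_{x,x+1} A_{x+1,x}` for a link and `f(u) = ∑ uⁿ/(n!)²`. By tridiagonality the
exponent of the angular integral involves only differences of neighbouring angles, which can be
integrated one at a time. For positive `l` the integral is therefore `exp(∑ A_{x,x} l_x)` times the
product over links of `g(√(l_x l_{x+1})) = f(p l_x l_{x+1})` (`gFun_eq_besselSeries`,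
`thetaIntegral_eq`), an expression that is smooth in `l` on the whole space.

The cofactor of a tridiagonal matrix splits into the minor on the sites left of `a`, the scalars
`A_{x,x+1}` for `a ≤ x < b`, and the minor on the sites right of `b` (`cofactorDet_of_tridiagonal`).
Each minor is a continuant, `D_{i+2} = N_{i+1,i+1} D_{i+1} - p_i D_i`, when built from the outer end
of `R` inward.

Conjugation by the exponential turns `∂_x - A_{x,x}` into `∂_x`. Since `f' + u f'' = f`, a link
weight `w = f(p s t)` satisfies `∂_s ∂_t w = p w`. When `∂_{x_{i+1}}` hits the product whose links
before `i + 1` are already differentiated, the product rule gives the next such product plus `p_i`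
times the product two stages back. The continuant recurrence subtracts exactly this extra term
(`diffOp_leadingMinor_mul`), so each minor differentiates each of its links once, in the outer
variable. -/

namespace LocalTimes

open scoped ContDiff

/-! ### Constant-coefficient differential operators on smooth functions -/

section DiffOp

variable {ι : Type*} [Fintype ι]

theorem hasDerivAt_update_line [DecidableEq ι] {F : (ι → ℝ) → ℂ} (hF : Differentiable ℝ F)
    (x : ι) (l : ι → ℝ) (t : ℝ) :
    HasDerivAt (fun s : ℝ => F (Function.update l x s))
      (fderiv ℝ F (Function.update l x t) (Pi.single x 1)) t :=
  (hF _).hasFDerivAt.comp_hasDerivAt t (hasDerivAt_update l x t)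

theorem partialDeriv_eq_fderiv [DecidableEq ι] {F : (ι → ℝ) → ℂ} (hF : Differentiable ℝ F)
    (x : ι) : partialDeriv x F = fun l => fderiv ℝ F l (Pi.single x 1) := by
  funext l
  have h := (hasDerivAt_update_line hF x l (l x)).deriv
  rwa [Function.update_eq_self] at h

theorem contDiff_partialDeriv [DecidableEq ι] {F : (ι → ℝ) → ℂ} (hF : ContDiff ℝ ∞ F)
    (x : ι) : ContDiff ℝ ∞ (partialDeriv x F) := by
  rw [partialDeriv_eq_fderiv (hF.differentiable (by simp))]
  exact (hF.fderiv_right (m := ∞) (by simp)).clm_apply contDiff_const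

theorem partialDeriv_comm [DecidableEq ι] {F : (ι → ℝ) → ℂ} (hF : ContDiff ℝ ∞ F) (x y : ι) :
    partialDeriv x (partialDeriv y F) = partialDeriv y (partialDeriv x F) := by
  have hd : Differentiable ℝ (fderiv ℝ F) :=
    (hF.fderiv_right (m := ∞) (by simp)).differentiable (by simp)
  rw [partialDeriv_eq_fderiv ((contDiff_partialDeriv hF y).differentiable (by simp)),
    partialDeriv_eq_fderiv ((contDiff_partialDeriv hF x).differentiable (by simp)),
    partialDeriv_eq_fderiv (hF.differentiable (by simp)),
    partialDeriv_eq_fderiv (hF.differentiable (by simp))]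
  funext l
  have hs : IsSymmSndFDerivAt ℝ F l :=
    hF.contDiffAt.isSymmSndFDerivAt (by simpa using WithTop.coe_le_coe.mpr (le_top : (2 : ℕ∞) ≤ ⊤))
  rw [fderiv_clm_apply (hd l) (by fun_prop), fderiv_clm_apply (hd l) (by fun_prop)]
  simpa using hs.eq (Pi.single x 1) (Pi.single y 1)

theorem contDiff_partialDeriv_iterate [DecidableEq ι] {F : (ι → ℝ) → ℂ} (hF : ContDiff ℝ ∞ F)
    (x : ι) (n : ℕ) : ContDiff ℝ ∞ ((partialDeriv x)^[n] F) := by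
  induction n with
  | zero => exact hF
  | succ n ih =>
    rw [Function.iterate_succ_apply']
    exact contDiff_partialDeriv ih x

theorem partialDeriv_iterate_comm [DecidableEq ι] {F : (ι → ℝ) → ℂ} (hF : ContDiff ℝ ∞ F)
    (x y : ι) (n : ℕ) :
    (partialDeriv x)^[n] (partialDeriv y F) = partialDeriv y ((partialDeriv x)^[n] F) := by
  induction n with
  | zero => rfl
  | succ n ih =>
    rw [Function.iterate_succ_apply', ih, Function.iterate_succ_apply',
      partialDeriv_comm (contDiff_partialDeriv_iterate hF x n)]

variable [LinearOrder ι]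

theorem contDiff_foldr_partialDeriv {F : (ι → ℝ) → ℂ} (hF : ContDiff ℝ ∞ F) (m : ι →₀ ℕ)
    (L : List ι) : ContDiff ℝ ∞ (L.foldr (fun x G => (partialDeriv x)^[m x] G) F) := by
  induction L with
  | nil => exact hF
  | cons y L ih => exact contDiff_partialDeriv_iterate ih y _

theorem contDiff_iteratedPartial {F : (ι → ℝ) → ℂ} (hF : ContDiff ℝ ∞ F) (m : ι →₀ ℕ) :
    ContDiff ℝ ∞ (iteratedPartial m F) :=
  contDiff_foldr_partialDeriv hF m _

/-- Partial derivatives of a smooth function commute, so the extra derivative can be pulled out of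
its place in the sorted fold. -/
theorem iteratedPartial_add_single {F : (ι → ℝ) → ℂ} (hF : ContDiff ℝ ∞ F) (m : ι →₀ ℕ)
    (x : ι) : iteratedPartial (Finsupp.single x 1 + m) F = partialDeriv x (iteratedPartial m F) := by
  have key : ∀ L : List ι, L.Nodup →
      L.foldr (fun y G => (partialDeriv y)^[(Finsupp.single x 1 + m : ι →₀ ℕ) y] G) F =
        if x ∈ L then partialDeriv x (L.foldr (fun y G => (partialDeriv y)^[m y] G) F)
        else L.foldr (fun y G => (partialDeriv y)^[m y] G) F := by
    intro L hL
    induction L with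
    | nil => simp
    | cons y L ih =>
      rw [List.nodup_cons] at hL
      rw [List.foldr_cons, ih hL.2, List.foldr_cons]
      have hG := contDiff_foldr_partialDeriv hF m L
      rcases eq_or_ne x y with rfl | hxy
      · rw [if_neg hL.1, if_pos List.mem_cons_self, Finsupp.add_apply, Finsupp.single_eq_same,
          Nat.add_comm, Function.iterate_succ_apply']
      · rw [Finsupp.add_apply, Finsupp.single_eq_of_ne hxy.symm, zero_add]
        by_cases hx : x ∈ L
        · rw [if_pos hx, if_pos (List.mem_cons_of_mem _ hx), partialDeriv_iterate_comm hG]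
        · rw [if_neg hx, if_neg (by simp [hxy, hx])]
  have := key _ (Finset.sort_nodup (Finset.univ : Finset ι) (fun x y : ι => x ≤ y))
  rwa [if_pos (by simp)] at this

theorem diffOp_eq_sum {p : MvPolynomial ι ℂ} {s : Finset (ι →₀ ℕ)} (hs : p.support ⊆ s)
    (F : (ι → ℝ) → ℂ) (l : ι → ℝ) :
    diffOp p F l = ∑ m ∈ s, p.coeff m * iteratedPartial m F l := by
  refine Finset.sum_subset hs fun m _ hm => ?_
  rw [MvPolynomial.notMem_support_iff.mp hm, zero_mul]

theorem diffOp_add (p q : MvPolynomial ι ℂ) (F : (ι → ℝ) → ℂ) :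
    diffOp (p + q) F = diffOp p F + diffOp q F := by
  classical
  funext l
  rw [Pi.add_apply, diffOp_eq_sum (MvPolynomial.support_add (p := p) (q := q)),
    diffOp_eq_sum (Finset.subset_union_left (s₁ := p.support) (s₂ := q.support)),
    diffOp_eq_sum (Finset.subset_union_right (s₁ := p.support) (s₂ := q.support)),
    ← Finset.sum_add_distrib]
  simp only [MvPolynomial.coeff_add, add_mul]

theorem diffOp_C_mul (c : ℂ) (p : MvPolynomial ι ℂ) (F : (ι → ℝ) → ℂ) :
    diffOp (MvPolynomial.C c * p) F = c • diffOp p F := by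
  funext l
  have hs : (MvPolynomial.C c * p).support ⊆ p.support := by
    intro m hm
    rw [MvPolynomial.mem_support_iff, MvPolynomial.coeff_C_mul] at hm
    exact MvPolynomial.mem_support_iff.mpr (right_ne_zero_of_mul hm)
  rw [diffOp_eq_sum hs, Pi.smul_apply, smul_eq_mul, diffOp, Finset.mul_sum]
  simp only [MvPolynomial.coeff_C_mul, mul_assoc]

theorem diffOp_monomial (m : ι →₀ ℕ) (c : ℂ) (F : (ι → ℝ) → ℂ) :
    diffOp (MvPolynomial.monomial m c) F = c • iteratedPartial m F := by
  classical
  funext l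
  rw [diffOp_eq_sum MvPolynomial.support_monomial_subset]
  simp

theorem diffOp_one (F : (ι → ℝ) → ℂ) : diffOp 1 F = F := by
  rw [← MvPolynomial.C_1, ← MvPolynomial.monomial_zero', diffOp_monomial, one_smul]
  have : ∀ L : List ι,
      L.foldr (fun y G => (partialDeriv y)^[(0 : ι →₀ ℕ) y] G) F = F := by
    intro L
    induction L with
    | nil => rfl
    | cons y L ih => exact ih
  exact this _

theorem contDiff_diffOp {F : (ι → ℝ) → ℂ} (hF : ContDiff ℝ ∞ F) (p : MvPolynomial ι ℂ) :
    ContDiff ℝ ∞ (diffOp p F) :=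
  ContDiff.sum fun m _ => contDiff_const.mul (contDiff_iteratedPartial hF m)

/-- With `diffOp_add` and `diffOp_C_mul`, this lets a product of symbols act one factor at a time.
-/
theorem diffOp_X_mul {F : (ι → ℝ) → ℂ} (hF : ContDiff ℝ ∞ F) (x : ι) (p : MvPolynomial ι ℂ) :
    diffOp (MvPolynomial.X x * p) F = partialDeriv x (diffOp p F) := by
  induction p using MvPolynomial.induction_on' with
  | monomial m c =>
    have hX : MvPolynomial.X x * MvPolynomial.monomial m c =
        MvPolynomial.monomial (Finsupp.single x 1 + m) c := by
      rw [MvPolynomial.X, MvPolynomial.monomial_mul, one_mul]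
    rw [hX, diffOp_monomial, diffOp_monomial, iteratedPartial_add_single hF]
    have hd := (contDiff_iteratedPartial hF m).differentiable (by simp)
    rw [partialDeriv_eq_fderiv hd, partialDeriv_eq_fderiv (hd.const_smul c)]
    funext l
    simp [fderiv_const_smul (hd l)]
  | add p q hp hq =>
    have hdp := (contDiff_diffOp hF p).differentiable (by simp)
    have hdq := (contDiff_diffOp hF q).differentiable (by simp)
    rw [mul_add, diffOp_add, hp, hq, diffOp_add, partialDeriv_eq_fderiv hdp,
      partialDeriv_eq_fderiv hdq, partialDeriv_eq_fderiv (hdp.add hdq)]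
    funext l
    simp [fderiv_add (hdp l) (hdq l)]

theorem partialDeriv_congr_pos {F G : (ι → ℝ) → ℂ}
    (h : ∀ l : ι → ℝ, (∀ x, 0 < l x) → F l = G l) (x : ι) (l : ι → ℝ) (hl : ∀ x, 0 < l x) :
    partialDeriv x F l = partialDeriv x G l := by
  refine Filter.EventuallyEq.deriv_eq ?_
  filter_upwards [lt_mem_nhds (hl x)] with t ht
  refine h _ fun y => ?_
  rcases eq_or_ne y x with rfl | hy
  · simpa using ht
  · simpa [hy] using hl y

/-- Equality on the open positive orthant passes to all derivatives there. It is needed because the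
angular integral contains square roots and is identified with a smooth function only on that
orthant. -/
theorem diffOp_congr_pos {F G : (ι → ℝ) → ℂ}
    (h : ∀ l : ι → ℝ, (∀ x, 0 < l x) → F l = G l) (p : MvPolynomial ι ℂ) (l : ι → ℝ)
    (hl : ∀ x, 0 < l x) : diffOp p F l = diffOp p G l := by
  refine Finset.sum_congr rfl fun m _ => ?_
  congr 1
  have iter : ∀ (x : ι) (n : ℕ) (F G : (ι → ℝ) → ℂ),
      (∀ l : ι → ℝ, (∀ x, 0 < l x) → F l = G l) →
      ∀ l : ι → ℝ, (∀ x, 0 < l x) → (partialDeriv x)^[n] F l = (partialDeriv x)^[n] G l := by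
    intro x n
    induction n with
    | zero => exact fun F G h => h
    | succ n ih =>
      intro F G h
      exact ih _ _ (partialDeriv_congr_pos h x)
  have fold : ∀ L : List ι, ∀ l : ι → ℝ, (∀ x, 0 < l x) →
      L.foldr (fun y G => (partialDeriv y)^[m y] G) F l =
        L.foldr (fun y G => (partialDeriv y)^[m y] G) G l := by
    intro L
    induction L with
    | nil => exact h
    | cons y L ih => exact iter y _ _ _ ih
  exact fold _ l hl

end DiffOp

end LocalTimes

/-! ### The Bessel-type series and the function `g` -/

namespace LocalTimes

open scoped ContDiff Nat

/-- The entire function `∑ u ^ n / (n! (n + k)!)`. -/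
noncomputable def besselSeries (k : ℕ) (u : ℝ) : ℂ :=
  ∑' n : ℕ, (u : ℂ) ^ n / ((n ! : ℂ) * ((n + k)! : ℂ))

theorem norm_besselTerm_le (k n : ℕ) {u r : ℝ} (hu : |u| ≤ r) :
    ‖(u : ℂ) ^ n / ((n ! : ℂ) * ((n + k)! : ℂ))‖ ≤ r ^ n / n ! := by
  have h1 : (1 : ℝ) ≤ ((n + k)! : ℝ) := by exact_mod_cast Nat.factorial_pos _
  have h2 : (0 : ℝ) < (n ! : ℝ) := by exact_mod_cast Nat.factorial_pos _
  rw [norm_div, norm_mul, norm_pow, Complex.norm_real, Complex.norm_natCast,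
    Complex.norm_natCast, Real.norm_eq_abs]
  have h0 : 0 ≤ r := (abs_nonneg u).trans hu
  refine div_le_div₀ (by positivity) (pow_le_pow_left₀ (abs_nonneg u) hu n) h2 ?_
  nlinarith

theorem summable_besselTerm (k : ℕ) (u : ℝ) :
    Summable fun n : ℕ => (u : ℂ) ^ n / ((n ! : ℂ) * ((n + k)! : ℂ)) :=
  Summable.of_norm_bounded (Real.summable_pow_div_factorial |u|)
    fun n => norm_besselTerm_le k n le_rfl

theorem besselTerm_deriv (k n : ℕ) (u : ℂ) :
    ((n + 1 : ℕ) : ℂ) * u ^ n / (((n + 1)! : ℂ) * ((n + 1 + k)! : ℂ)) =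
      u ^ n / ((n ! : ℂ) * ((n + (k + 1))! : ℂ)) := by
  rw [Nat.factorial_succ n, show n + 1 + k = n + (k + 1) by ring]
  have h1 : ((n + 1 : ℕ) : ℂ) ≠ 0 := by exact_mod_cast Nat.succ_ne_zero n
  push_cast at h1 ⊢
  rw [mul_assoc, mul_div_mul_left _ _ h1]

theorem hasDerivAt_besselSeries (k : ℕ) (u : ℝ) :
    HasDerivAt (besselSeries k) (besselSeries (k + 1) u) u := by
  -- The ball around `0` must contain both `u` and `0`, the point where convergence of the series
  -- itself is checked.
  set r : ℝ := |u| + 1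
  have hr : 0 < r := by positivity
  let g' : ℕ → ℝ → ℂ := fun n y =>
    (n : ℂ) * (y : ℂ) ^ (n - 1) / ((n ! : ℂ) * ((n + k)! : ℂ))
  have hb : ∀ n, ∀ y ∈ Metric.ball (0 : ℝ) r, ‖g' n y‖ ≤
      (fun n : ℕ => if n = 0 then 0 else r ^ (n - 1) / ((n - 1)! : ℝ)) n := by
    intro n y hy
    cases n with
    | zero => simp [g']
    | succ n =>
      have : |y| ≤ r := by simpa using (Metric.mem_ball.mp hy).le
      simp only [g', Nat.add_sub_cancel, besselTerm_deriv, Nat.succ_ne_zero, if_false]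
      exact norm_besselTerm_le (k + 1) n this
  have hsum : Summable (fun n : ℕ => if n = 0 then 0 else r ^ (n - 1) / ((n - 1)! : ℝ)) := by
    rw [← summable_nat_add_iff 1]
    simpa using Real.summable_pow_div_factorial r
  have key := hasDerivAt_tsum_of_isPreconnected
    (g := fun (n : ℕ) (y : ℝ) => (y : ℂ) ^ n / ((n ! : ℂ) * ((n + k)! : ℂ))) (g' := g')
    hsum Metric.isOpen_ball
    ((convex_ball (0 : ℝ) r).isPreconnected)
    (fun n y _ => ((Complex.ofRealCLM.hasDerivAt (x := y)).pow n |>.div_const _).congr_deriv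
      (by simp [g'])) hb
    (Metric.mem_ball_self hr) (summable_besselTerm k 0) (y := u) (by simp [r])
  refine key.congr_deriv ?_
  have hs' : Summable (fun n => g' n u) :=
    Summable.of_norm_bounded hsum fun n => hb n u (by simp [r])
  -- The differentiated term at `n = 0` vanishes; shifting the others by one gives the series with
  -- `k + 1`.
  rw [hs'.tsum_eq_zero_add]
  simp only [g', Nat.add_sub_cancel, besselTerm_deriv]
  simp [besselSeries]

theorem contDiff_besselSeries (k : ℕ) : ContDiff ℝ ∞ (besselSeries k) := by
  rw [contDiff_infty]
  intro n
  induction n generalizing k with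
  | zero =>
    exact contDiff_zero.mpr
      (continuous_iff_continuousAt.mpr fun u => (hasDerivAt_besselSeries k u).continuousAt)
  | succ n ih =>
    push_cast
    rw [contDiff_succ_iff_deriv]
    refine ⟨fun u => (hasDerivAt_besselSeries k u).differentiableAt, by simp, ?_⟩
    rw [show deriv (besselSeries k) = besselSeries (k + 1) from
      funext fun u => (hasDerivAt_besselSeries k u).deriv]
    exact ih (k + 1)

/-- This is the Bessel equation `f' + u f'' = f` for `f = besselSeries 0`, since differentiation
raises the index by one. Coefficientwise it says `1 + (n + 1) = n + 2`. -/
theorem besselSeries_recurrence (u : ℝ) :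
    besselSeries 1 u + u * besselSeries 2 u = besselSeries 0 u := by
  have h1 := (summable_besselTerm 1 u)
  have h2 := (summable_besselTerm 2 u)
  have h0 := (summable_besselTerm 0 u)
  rw [besselSeries, besselSeries, besselSeries, h1.tsum_eq_zero_add, h0.tsum_eq_zero_add,
    ← tsum_mul_left, add_assoc, ← Summable.tsum_add ((summable_nat_add_iff 1).mpr h1)
      (h2.mul_left _)]
  congr 1
  refine tsum_congr fun n => ?_
  have e1 : ((n + 1)! : ℂ) = (n + 1) * n ! := by rw [Nat.factorial_succ]; push_cast; ring
  have e2 : ((n + 2)! : ℂ) = (n + 2) * ((n + 1) * n !) := by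
    rw [Nat.factorial_succ, Nat.factorial_succ]; push_cast; ring
  have h3 : (n ! : ℂ) ≠ 0 := by exact_mod_cast Nat.factorial_ne_zero n
  have h4 : (n + 1 : ℂ) ≠ 0 := by exact_mod_cast Nat.succ_ne_zero n
  have h5 : (n + 2 : ℂ) ≠ 0 := by exact_mod_cast Nat.succ_ne_zero (n + 1)
  rw [show n + 1 + 1 = n + 2 from rfl, add_zero, e1, e2]
  field_simp
  ring

theorem integral_exp_int_mul_I (k n : ℕ) :
    ∫ θ in (0 : ℝ)..(2 * Real.pi),
      Complex.exp (Complex.I * θ) ^ k * Complex.exp (-(Complex.I * θ)) ^ n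
        * (1 / (2 * (Real.pi : ℂ))) = if k = n then 1 else 0 := by
  have hpi : (Real.pi : ℂ) ≠ 0 := by exact_mod_cast Real.pi_ne_zero
  have he : ∀ θ : ℝ, Complex.exp (Complex.I * θ) ^ k * Complex.exp (-(Complex.I * θ)) ^ n
      = Complex.exp (((k : ℂ) - n) * Complex.I * θ) := by
    intro θ
    rw [← Complex.exp_nat_mul, ← Complex.exp_nat_mul, ← Complex.exp_add]
    congr 1
    ring
  simp_rw [he]
  rw [intervalIntegral.integral_mul_const]
  split_ifs with h
  · subst h
    simp
    field_simp
  · have hc : ((k : ℂ) - n) * Complex.I ≠ 0 :=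
      mul_ne_zero (sub_ne_zero.mpr (by exact_mod_cast h)) Complex.I_ne_zero
    rw [integral_exp_mul_complex hc]
    have : Complex.exp (((k : ℂ) - n) * Complex.I * ((2 * Real.pi : ℝ) : ℂ)) = 1 := by
      rw [Complex.exp_eq_one_iff]
      exact ⟨(k : ℤ) - n, by push_cast; ring⟩
    rw [this]
    simp

theorem hasSum_exp_mul_exp (z w : ℂ) :
    HasSum (fun q : ℕ × ℕ => z ^ q.1 / (q.1 ! : ℂ) * (w ^ q.2 / (q.2 ! : ℂ)))
      (Complex.exp z * Complex.exp w) := by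
  have hns : ∀ z : ℂ, Summable fun n : ℕ => ‖z ^ n / (n ! : ℂ)‖ := by
    intro z
    simpa using Real.summable_pow_div_factorial ‖z‖
  have hexp : ∀ z : ℂ, ∑' n : ℕ, z ^ n / (n ! : ℂ) = Complex.exp z := by
    intro z
    rw [Complex.exp_eq_exp_ℂ]
    exact (NormedSpace.expSeries_div_hasSum_exp z).tsum_eq
  have h := (summable_mul_of_summable_norm (hns z) (hns w)).hasSum
  rwa [← tsum_mul_tsum_of_summable_norm (hns z) (hns w), hexp, hexp] at h

/-- Expand both exponentials into an absolutely convergent double series and integrate termwise;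
orthogonality of the characters leaves the diagonal. -/
theorem integral_exp_add_exp_neg (α β : ℂ) :
    HasSum (fun n : ℕ => (α * β) ^ n / ((n ! : ℂ) * (n ! : ℂ)))
      (∫ θ in (0 : ℝ)..(2 * Real.pi),
        Complex.exp (α * Complex.exp (Complex.I * θ) + β * Complex.exp (-(Complex.I * θ)))
          * (1 / (2 * (Real.pi : ℂ)))) := by
  let f : ℕ × ℕ → ℝ → ℂ := fun q θ =>
    (α * Complex.exp (Complex.I * θ)) ^ q.1 / (q.1 ! : ℂ) *
      ((β * Complex.exp (-(Complex.I * θ))) ^ q.2 / (q.2 ! : ℂ)) * (1 / (2 * (Real.pi : ℂ)))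
  have hn1 : ∀ θ : ℝ, ‖Complex.exp (Complex.I * θ)‖ = 1 := by
    intro θ; rw [mul_comm]; exact Complex.norm_exp_ofReal_mul_I θ
  have hn2 : ∀ θ : ℝ, ‖Complex.exp (-(Complex.I * θ))‖ = 1 := by
    intro θ; rw [Complex.exp_neg, norm_inv, hn1, inv_one]
  have hs : ∀ γ : ℂ, Summable fun n : ℕ => ‖γ‖ ^ n / (n ! : ℝ) :=
    fun γ => Real.summable_pow_div_factorial _
  have hF : ∀ q, Continuous (f q) := fun q => by
    simp only [f]
    fun_prop
  have hbound : ∀ q θ, ‖f q θ‖ ≤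
      ‖α‖ ^ q.1 / (q.1 ! : ℝ) * (‖β‖ ^ q.2 / (q.2 ! : ℝ)) * ‖1 / (2 * (Real.pi : ℂ))‖ := by
    intro q θ
    refine le_of_eq ?_
    simp only [f]
    rw [norm_mul, norm_mul, norm_div, norm_div, norm_pow, norm_pow, norm_mul, norm_mul, hn1, hn2,
      mul_one, mul_one, Complex.norm_natCast, Complex.norm_natCast]
  have hsum : Summable fun q : ℕ × ℕ =>
      ‖α‖ ^ q.1 / (q.1 ! : ℝ) * (‖β‖ ^ q.2 / (q.2 ! : ℝ)) * ‖1 / (2 * (Real.pi : ℂ))‖ := by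
    refine Summable.mul_right _ ?_
    exact Summable.mul_of_nonneg (hs α) (hs β) (fun n => by positivity) (fun n => by positivity)
  have hlim : ∀ θ : ℝ, HasSum (fun q => f q θ)
      (Complex.exp (α * Complex.exp (Complex.I * θ)
        + β * Complex.exp (-(Complex.I * θ))) * (1 / (2 * (Real.pi : ℂ)))) := by
    intro θ
    rw [Complex.exp_add]
    exact (hasSum_exp_mul_exp _ _).mul_right _
  have key := intervalIntegral.hasSum_integral_of_dominated_convergence
    (μ := MeasureTheory.volume) (a := 0) (b := 2 * Real.pi) (F := f) _
    (fun q => (hF q).aestronglyMeasurable)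
    (fun q => Filter.Eventually.of_forall fun θ _ => hbound q θ)
    (Filter.Eventually.of_forall fun θ _ => hsum)
    intervalIntegrable_const
    (Filter.Eventually.of_forall fun θ _ => hlim θ)
  have hint : ∀ q : ℕ × ℕ, ∫ θ in (0 : ℝ)..(2 * Real.pi), f q θ =
      if q.1 = q.2 then α ^ q.1 / (q.1 ! : ℂ) * (β ^ q.2 / (q.2 ! : ℂ)) else 0 := by
    intro q
    have : ∀ θ : ℝ, f q θ = α ^ q.1 / (q.1 ! : ℂ) * (β ^ q.2 / (q.2 ! : ℂ)) *
        (Complex.exp (Complex.I * θ) ^ q.1 * Complex.exp (-(Complex.I * θ)) ^ q.2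
        * (1 / (2 * (Real.pi : ℂ)))) := by
      intro θ
      simp only [f, mul_pow]
      ring
    simp_rw [this]
    rw [intervalIntegral.integral_const_mul, integral_exp_int_mul_I]
    split_ifs <;> simp
  simp_rw [hint] at key
  have hinj : Function.Injective fun n : ℕ => (n, n) := fun _ _ h => (Prod.mk.inj h).1
  rw [← hinj.hasSum_iff] at key
  · refine key.congr_fun ?_
    intro n
    simp [mul_pow]
    ring
  · rintro ⟨k, n⟩ hkn
    exact if_neg fun h => hkn ⟨k, Prod.ext rfl h⟩

theorem gFun_eq_besselSeries {Λ : Type*} [DecidableEq Λ] (A : Matrix Λ Λ ℝ) {x y : Λ}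
    (hxy : x ≠ y) (t : ℝ) : gFun A x y t = besselSeries 0 (A x y * A y x * t ^ 2) := by
  have h := (integral_exp_add_exp_neg (t * A x y) (t * A y x)).tsum_eq
  rw [besselSeries, gFun]
  simp only [offDiagPart, Matrix.of_apply, if_neg hxy, if_neg hxy.symm, mul_add, ← mul_assoc]
  rw [← h]
  refine tsum_congr fun n => ?_
  push_cast
  congr 2
  ring

end LocalTimes

/-! ### Continuants and cofactors of tridiagonal matrices -/

namespace LocalTimes

section Determinants

variable {K : Type*} [CommRing K]

/-- The leading principal minor of size `n` of an infinite matrix. -/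
def leadingMinor (N : ℕ → ℕ → K) (n : ℕ) : K :=
  Matrix.det (Matrix.of fun i j : Fin n => N i j)

theorem leadingMinor_zero (N : ℕ → ℕ → K) : leadingMinor N 0 = 1 := by
  simp [leadingMinor]

theorem leadingMinor_one (N : ℕ → ℕ → K) : leadingMinor N 1 = N 0 0 := by
  simp [leadingMinor]

/-- Expand along the last row, which has two possibly nonzero entries, then expand the off-diagonal
minor along its last column. -/
theorem leadingMinor_add_two (N : ℕ → ℕ → K) (n : ℕ) (hrow : ∀ j < n, N (n + 1) j = 0)
    (hcol : ∀ i < n, N i (n + 1) = 0) :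
    leadingMinor N (n + 2) = N (n + 1) (n + 1) * leadingMinor N (n + 1)
      - N n (n + 1) * N (n + 1) n * leadingMinor N n := by
  have hminor : (Matrix.det ((Matrix.of fun i j : Fin (n + 2) => N i j).submatrix
      (Fin.last (n + 1)).succAbove (Fin.last n).castSucc.succAbove)) =
      N n (n + 1) * leadingMinor N n := by
    rw [Matrix.det_succ_column _ (Fin.last n), Fin.sum_univ_castSucc,
      Finset.sum_eq_zero, zero_add]
    · simp only [Fin.val_last, ← two_mul, pow_mul, neg_one_sq, one_pow, one_mul]
      congr 1
      · simp [Fin.succAbove]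
      · rw [leadingMinor]
        congr 1
        ext i j
        have : ((Fin.last n).castSucc.succAbove j.castSucc : Fin (n + 2)) =
            j.castSucc.castSucc := Fin.succAbove_of_castSucc_lt _ _ (by simp [Fin.lt_def])
        simp [this]
    · intro i _
      simp [Fin.succAbove, hcol i i.2]
  rw [leadingMinor, Matrix.det_succ_row _ (Fin.last (n + 1)), Fin.sum_univ_castSucc,
    Fin.sum_univ_castSucc, Finset.sum_eq_zero, zero_add, hminor]
  · have h1 : (-1 : K) ^ (n + 1 + n) = -1 := by
      rw [show n + 1 + n = 2 * n + 1 by ring, pow_succ, pow_mul]; simp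
    have h2 : (-1 : K) ^ (n + 1 + (n + 1)) = 1 := by
      rw [← two_mul, pow_mul]; simp
    simp only [Fin.val_last, Fin.val_castSucc, h1, h2, Matrix.of_apply]
    have h3 : Matrix.det ((Matrix.of fun i j : Fin (n + 2) => N i j).submatrix
        (Fin.last (n + 1)).succAbove (Fin.last (n + 1)).succAbove) = leadingMinor N (n + 1) := by
      rw [leadingMinor]
      congr 1
      ext i j
      simp
    rw [h3]
    ring
  · intro i _
    simp [hrow i i.2]

/-- This row shift brings row `b = a + n` of the cofactor matrix to position `a` and moves the rows
`a, …, b - 1` down by one. It is a product of `n` adjacent transpositions, hence the sign. -/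
theorem exists_perm_cycle {c d : ℤ} (r : ℤ → Finset.Icc c d)
    (hr : ∀ x ∈ Finset.Icc c d, (r x : ℤ) = x) {a : ℤ} (hca : c ≤ a) (n : ℕ) (hn : a + n ≤ d) :
    ∃ σ : Equiv.Perm (Finset.Icc c d), Equiv.Perm.sign σ = (-1) ^ n ∧
      ∀ x, (σ x : ℤ) = if (x : ℤ) < a ∨ a + n < x then (x : ℤ) else
        if (x : ℤ) = a then a + n else x - 1 := by
  induction n with
  | zero =>
    refine ⟨1, by simp, fun x => ?_⟩
    simp only [Equiv.Perm.coe_one, id_eq]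
    split_ifs <;> push_cast at * <;> omega
  | succ n ih =>
    push_cast at hn
    obtain ⟨σ, hs, hσ⟩ := ih (by omega)
    have h1 : (r (a + n) : ℤ) = a + n := hr _ (by rw [Finset.mem_Icc]; omega)
    have h2 : (r (a + n + 1) : ℤ) = a + n + 1 := hr _ (by rw [Finset.mem_Icc]; omega)
    refine ⟨Equiv.swap (r (a + n)) (r (a + n + 1)) * σ, ?_, fun x => ?_⟩
    · rw [Equiv.Perm.sign_mul, hs, Equiv.Perm.sign_swap, pow_succ, mul_comm]
      intro h
      have := congrArg Subtype.val h
      omega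
    · have hx := hσ x
      rw [Equiv.Perm.mul_apply, Equiv.swap_apply_def]
      push_cast
      have e1 : σ x = r (a + n) ↔ (σ x : ℤ) = a + n := by rw [Subtype.ext_iff, h1]
      have e2 : σ x = r (a + n + 1) ↔ (σ x : ℤ) = a + n + 1 := by rw [Subtype.ext_iff, h2]
      rw [apply_ite Subtype.val, apply_ite Subtype.val, h1, h2]
      simp only [e1, e2]
      split_ifs at hx ⊢ <;> omega

theorem det_eq_leadingMinor {ι : Type*} [Fintype ι] [DecidableEq ι] (T : Matrix ι ι K) (n : ℕ)
    (e : Fin n → ι) (he : Function.Bijective e) (N : ℕ → ℕ → K)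
    (h : ∀ i j : Fin n, T (e i) (e j) = N i j) : T.det = leadingMinor N n := by
  rw [← Matrix.det_submatrix_equiv_self (Equiv.ofBijective e he), leadingMinor]
  congr 1
  ext i j
  exact h i j

-- After the cyclic row shift the matrix is block lower triangular: the block `x < a`, singletons
-- for `a ≤ x ≤ b`, and the block `x > b`. The singletons contribute `1` at `a` and `M (x - 1) x`
-- for `a < x ≤ b`. The map `r` lets indices be computed in `ℤ`. The last minor is numbered from `d`
-- downward so that it too grows from the outer end.
set_option maxHeartbeats 1000000 in
theorem cofactorDet_of_tridiagonal {c d a b : ℤ} (r : ℤ → Finset.Icc c d)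
    (hr : ∀ x ∈ Finset.Icc c d, (r x : ℤ) = x) (hca : c ≤ a) (hab : a ≤ b) (hbd : b ≤ d)
    (M : Matrix (Finset.Icc c d) (Finset.Icc c d) K)
    (hM : ∀ x y : Finset.Icc c d, 2 ≤ |(x : ℤ) - y| → M x y = 0) :
    cofactorDet (r a) (r b) M =
      leadingMinor (fun i j => M (r (c + i)) (r (c + j))) (a - c).toNat
        * (∏ x ∈ Finset.Ico a b, -M (r x) (r (x + 1)))
        * leadingMinor (fun i j => M (r (d - i)) (r (d - j))) (d - b).toNat := by
  have hra : (r a : ℤ) = a := hr _ (by rw [Finset.mem_Icc]; omega)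
  have hrb : (r b : ℤ) = b := hr _ (by rw [Finset.mem_Icc]; omega)
  have hr' : ∀ x : Finset.Icc c d, r x = x := fun x => Subtype.ext (hr _ x.2)
  have hmem : ∀ x : Finset.Icc c d, c ≤ (x : ℤ) ∧ (x : ℤ) ≤ d := fun x => Finset.mem_Icc.mp x.2
  obtain ⟨σ, hs, hσ⟩ := exists_perm_cycle r hr hca (b - a).toNat (by omega)
  have hn : a + ((b - a).toNat : ℤ) = b := by omega
  simp only [hn] at hσ
  set N : Matrix (Finset.Icc c d) (Finset.Icc c d) K := Matrix.of fun x y =>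
    (if x ≠ r b then 1 else 0) * M x y * (if y ≠ r a then 1 else 0)
      + (if x = r b ∧ y = r a then 1 else 0) with hN
  have hNe : ∀ x y, N x y = if (x : ℤ) = b then (if (y : ℤ) = a then 1 else 0) else
      if (y : ℤ) = a then 0 else M x y := by
    intro x y
    have e1 : x = r b ↔ (x : ℤ) = b := by rw [Subtype.ext_iff, hrb]
    have e2 : y = r a ↔ (y : ℤ) = a := by rw [Subtype.ext_iff, hra]
    simp only [hN, Matrix.of_apply, ne_eq, e1, e2]
    split_ifs <;> simp_all
  set P : Matrix (Finset.Icc c d) (Finset.Icc c d) K := N.submatrix σ id with hP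
  have hdet : cofactorDet (r a) (r b) M = (-1) ^ (b - a).toNat * P.det := by
    rw [hP, Matrix.det_permute, hs]
    push_cast
    rw [← mul_assoc, ← mul_pow]
    simp [cofactorDet, hN]
  set f : Finset.Icc c d → ℤ := fun x =>
    if (x : ℤ) < a then a - 1 else if (x : ℤ) ≤ b then x else b + 1 with hf
  have hPe : ∀ x y, P x y = N (σ x) y := fun x y => rfl
  have htri : Matrix.BlockTriangular P.transpose f := by
    intro x y hxy
    rw [Matrix.transpose_apply, hPe, hNe]
    have h1 := hσ y
    have key : M (σ y) x = 0 ∨ (σ y : ℤ) - x < 2 ∧ x - (σ y : ℤ) < 2 := by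
      by_contra! h
      refine h.1 (hM _ _ (le_abs.mpr ?_))
      omega
    simp only [hf] at hxy
    have h2 : (σ y : ℤ) = b → (x : ℤ) ≠ a := by
      split_ifs at hxy h1 <;> omega
    -- Above the block diagonal, away from row `b` and column `a`, an entry comes from two sites at
    -- distance at least 2: the shift adds one to the distance inside `(a, b]`, and column `a`
    -- separates off the block `x < a`.
    have h3 : (σ y : ℤ) ≠ b → (x : ℤ) ≠ a → ¬ ((σ y : ℤ) - x < 2 ∧ x - (σ y : ℤ) < 2) := by
      split_ifs at hxy h1 <;> omega
    split_ifs with h4 h5 h5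
    · exact absurd h5 (h2 h4)
    · rfl
    · rfl
    · exact key.resolve_right (h3 h4 h5)
  set D : ℤ → K := fun k => (P.transpose.toSquareBlock f k).det with hD
  have hprod : P.det = ∏ k ∈ Finset.Icc (a - 1) (b + 1), D k := by
    rw [← Matrix.det_transpose, htri.det]
    refine Finset.prod_subset ?_ fun k _ hk => ?_
    · intro k hk
      obtain ⟨x, -, rfl⟩ := Finset.mem_image.mp hk
      simp only [hf, Finset.mem_Icc]
      split_ifs <;> omega
    · have : IsEmpty { i // f i = k } :=
        ⟨fun i => hk <| Finset.mem_image.2 ⟨i, Finset.mem_univ _, i.2⟩⟩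
      exact Matrix.det_isEmpty
  have hsplit : Finset.Icc (a - 1) (b + 1) =
      insert (a - 1) (insert (b + 1) (insert a (Finset.Ioc a b))) := by
    ext x
    simp only [Finset.mem_Icc, Finset.mem_insert, Finset.mem_Ioc]
    omega
  have hsingle : ∀ k, ∀ hk : a ≤ k ∧ k ≤ b, D k = P (r k) (r k) := by
    intro k hk
    have hrk : (r k : ℤ) = k := hr _ (by rw [Finset.mem_Icc]; omega)
    have hsub : Subsingleton { i // f i = k } := by
      refine ⟨fun i j => Subtype.ext (Subtype.ext ?_)⟩
      have hi := i.2
      have hj := j.2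
      simp only [hf] at hi hj
      split_ifs at hi hj <;> omega
    have hfk : f (r k) = k := by
      simp only [hf, hrk]
      split_ifs <;> omega
    rw [hD]
    exact Matrix.det_eq_elem_of_subsingleton _ (⟨r k, hfk⟩ : { i // f i = k })
  have hDa : D a = 1 := by
    have h1 := hσ (r a)
    rw [hra, if_neg (by omega), if_pos rfl] at h1
    rw [hsingle a ⟨le_rfl, hab⟩, hPe, hNe, if_pos h1, if_pos hra]
  have hDmid : ∀ k ∈ Finset.Ioc a b, D k = M (r (k - 1)) (r k) := by
    intro k hk
    rw [Finset.mem_Ioc] at hk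
    have hrk : (r k : ℤ) = k := hr _ (by rw [Finset.mem_Icc]; omega)
    have h1 := hσ (r k)
    rw [hrk, if_neg (by omega), if_neg (by omega)] at h1
    rw [hsingle k ⟨hk.1.le, hk.2⟩, hPe, hNe, if_neg (by omega), if_neg (by omega),
      ← hr' (σ (r k)), h1]
  have hDlow : D (a - 1) =
      leadingMinor (fun i j => M (r (c + i)) (r (c + j))) (a - c).toNat := by
    have hri : ∀ i : Fin (a - c).toNat, (r (c + (i : ℕ)) : ℤ) = c + (i : ℕ) := fun i =>
      hr _ (by rw [Finset.mem_Icc]; omega)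
    rw [hD]
    simp only
    rw [← Matrix.det_transpose]
    refine det_eq_leadingMinor _ _
      (fun i => ⟨r (c + (i : ℕ)), by simp only [hf, hri]; split_ifs <;> omega⟩)
      ⟨fun i j hij => ?_, fun x => ?_⟩ _ fun i j => ?_
    · have := congrArg (fun z => ((z.1 : Finset.Icc c d) : ℤ)) hij
      simp only [hri] at this
      omega
    · have hx := x.2
      simp only [hf] at hx
      have hm := hmem x.1
      refine ⟨⟨((x.1 : ℤ) - c).toNat, by split_ifs at hx <;> omega⟩, ?_⟩
      refine Subtype.ext ?_
      simp only
      rw [Int.toNat_of_nonneg (by omega), add_sub_cancel, hr']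
    · simp only [Matrix.transpose_apply, Matrix.toSquareBlock_def, Matrix.of_apply, hPe, hNe]
      have h1 := hσ (r (c + (i : ℕ)))
      rw [hri, if_pos (by omega)] at h1
      rw [if_neg (by omega), hri, if_neg (by omega), ← hr' (σ _), h1]
  have hDup : D (b + 1) =
      leadingMinor (fun i j => M (r (d - i)) (r (d - j))) (d - b).toNat := by
    have hri : ∀ i : Fin (d - b).toNat, (r (d - (i : ℕ)) : ℤ) = d - (i : ℕ) := fun i =>
      hr _ (by rw [Finset.mem_Icc]; omega)
    rw [hD]
    simp only
    rw [← Matrix.det_transpose]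
    refine det_eq_leadingMinor _ _
      (fun i => ⟨r (d - (i : ℕ)), by simp only [hf, hri]; split_ifs <;> omega⟩)
      ⟨fun i j hij => ?_, fun x => ?_⟩ _ fun i j => ?_
    · have := congrArg (fun z => ((z.1 : Finset.Icc c d) : ℤ)) hij
      simp only [hri] at this
      omega
    · have hx := x.2
      simp only [hf] at hx
      have hm := hmem x.1
      refine ⟨⟨(d - (x.1 : ℤ)).toNat, by split_ifs at hx <;> omega⟩, ?_⟩
      refine Subtype.ext ?_
      simp only
      rw [Int.toNat_of_nonneg (by omega), sub_sub_cancel, hr']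
    · simp only [Matrix.transpose_apply, Matrix.toSquareBlock_def, Matrix.of_apply, hPe, hNe]
      have h1 := hσ (r (d - (i : ℕ)))
      rw [hri, if_pos (by omega)] at h1
      rw [if_neg (by omega), hri, if_neg (by omega), ← hr' (σ _), h1]
  have hmid : ∏ k ∈ Finset.Ioc a b, D k = ∏ x ∈ Finset.Ico a b, M (r x) (r (x + 1)) := by
    rw [Finset.prod_congr rfl hDmid]
    refine Finset.prod_nbij' (fun k => k - 1) (fun x => x + 1) ?_ ?_ ?_ ?_ ?_
    · intro k hk
      rw [Finset.mem_Ioc] at hk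
      rw [Finset.mem_Ico]
      omega
    · intro k hk
      rw [Finset.mem_Ico] at hk
      rw [Finset.mem_Ioc]
      omega
    all_goals simp
  -- The sign `(-1)^(b - a)` of the shift is what turns each `M x (x + 1)` into its negative.
  rw [hdet, hprod, hsplit, Finset.prod_insert (by simp; omega), Finset.prod_insert (by simp; omega),
    Finset.prod_insert (by simp), hDa, hmid, hDlow, hDup, Finset.prod_neg, Int.card_Ico]
  ring

end Determinants

end LocalTimes

/-! ### Continuant operators acting on a chain of links -/

namespace LocalTimes

open scoped ContDiff

section Chain

variable {ι : Type*}

/-- The weight `∑ (p s t) ^ n / (n!) ^ 2` of the link between the variables `l (x j) = s` and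
`l (x (j + 1)) = t`. -/
noncomputable def linkWeight (x : ℕ → ι) (p : ℕ → ℝ) (j : ℕ) (l : ι → ℝ) : ℂ :=
  besselSeries 0 (p j * (l (x j) * l (x (j + 1))))

/-- The derivative of `linkWeight x p j` in the variable `l (x j)`. -/
noncomputable def linkDeriv (x : ℕ → ι) (p : ℕ → ℝ) (j : ℕ) (l : ι → ℝ) : ℂ :=
  p j * l (x (j + 1)) * besselSeries 1 (p j * (l (x j) * l (x (j + 1))))

/-- The product of the first `i` link derivatives and of the remaining `m - i` link weights. -/
noncomputable def linkProd (x : ℕ → ι) (p : ℕ → ℝ) (m i : ℕ) (l : ι → ℝ) : ℂ :=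
  (∏ j ∈ Finset.range i, linkDeriv x p j l) * ∏ j ∈ Finset.Ico i m, linkWeight x p j l

/-- The diagonal factor `exp (∑ A_{x,x} l_x)`. -/
noncomputable def diagFactor [Fintype ι] (α : ι → ℝ) (l : ι → ℝ) : ℂ :=
  Complex.exp (∑ x, (α x : ℂ) * (l x : ℂ))

theorem hasDerivAt_diagFactor [Fintype ι] [DecidableEq ι] (α : ι → ℝ) (l : ι → ℝ) (y : ι) :
    HasDerivAt (fun t => diagFactor α (Function.update l y t)) (α y * diagFactor α l) (l y) := by
  have h1 : ∀ x, HasDerivAt (fun t : ℝ => ((Function.update l y t x : ℝ) : ℂ))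
      (((Pi.single y 1 : ι → ℝ) x : ℝ) : ℂ) (l y) := fun x =>
    (hasDerivAt_pi.mp (hasDerivAt_update l y (l y)) x).ofReal_comp
  have h2 : HasDerivAt (fun t : ℝ => ∑ x, (α x : ℂ) * ((Function.update l y t x : ℝ) : ℂ))
      (∑ x, (α x : ℂ) * (((Pi.single y 1 : ι → ℝ) x : ℝ) : ℂ)) (l y) :=
    HasDerivAt.fun_sum fun x _ => (h1 x).const_mul _
  refine h2.cexp.congr_deriv ?_
  have h3 : ∑ x, (α x : ℂ) * (((Pi.single y 1 : ι → ℝ) x : ℝ) : ℂ) = α y := by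
    rw [Finset.sum_eq_single y (fun x _ hx => by simp [hx]) (by simp)]
    simp
  rw [h3]
  simp [diagFactor, mul_comm]

theorem hasDerivAt_besselSeries_mul (k : ℕ) (c s : ℝ) :
    HasDerivAt (fun t : ℝ => besselSeries k (c * t)) (c * besselSeries (k + 1) (c * s)) s := by
  have h := (hasDerivAt_besselSeries k (c * s)).scomp s ((hasDerivAt_id s).const_mul c)
  refine h.congr_deriv ?_
  simp

theorem hasDerivAt_linkWeight [DecidableEq ι] (x : ℕ → ι) (p : ℕ → ℝ) (j : ℕ) (l : ι → ℝ)
    (hne : x j ≠ x (j + 1)) :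
    HasDerivAt (fun t => linkWeight x p j (Function.update l (x j) t)) (linkDeriv x p j l)
      (l (x j)) := by
  have h := hasDerivAt_besselSeries_mul 0 (p j * l (x (j + 1))) (l (x j))
  simp only [linkWeight, linkDeriv, Function.update_self, Function.update_of_ne hne.symm]
  convert h using 2
  · ring_nf
  · push_cast; ring
  · ring_nf

/-- The identity `∂_s ∂_t w = p w` for `w = f(p s t)`, a form of `besselSeries_recurrence`. -/
theorem hasDerivAt_linkDeriv [DecidableEq ι] (x : ℕ → ι) (p : ℕ → ℝ) (j : ℕ) (l : ι → ℝ)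
    (hne : x j ≠ x (j + 1)) :
    HasDerivAt (fun t => linkDeriv x p j (Function.update l (x (j + 1)) t))
      (p j * linkWeight x p j l) (l (x (j + 1))) := by
  have h := hasDerivAt_besselSeries_mul 1 (p j * l (x j)) (l (x (j + 1)))
  have h' := (((hasDerivAt_id (l (x (j + 1)))).ofReal_comp).const_mul (p j : ℂ)).mul h
  simp only [linkWeight, linkDeriv, Function.update_self, Function.update_of_ne hne]
  have hrec := besselSeries_recurrence (p j * (l (x j) * l (x (j + 1))))
  rw [← hrec]
  refine (h'.congr_deriv ?_).congr_of_eventuallyEq (Filter.Eventually.of_forall fun t => ?_)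
  · simp only [id_eq, mul_assoc]
    push_cast
    ring
  · simp [mul_assoc]

theorem linkWeight_update [DecidableEq ι] (x : ℕ → ι) (p : ℕ → ℝ) (j : ℕ) (l : ι → ℝ) {y : ι}
    (h0 : x j ≠ y) (h1 : x (j + 1) ≠ y) (t : ℝ) :
    linkWeight x p j (Function.update l y t) = linkWeight x p j l := by
  simp only [linkWeight, Function.update_of_ne h0, Function.update_of_ne h1]

theorem linkDeriv_update [DecidableEq ι] (x : ℕ → ι) (p : ℕ → ℝ) (j : ℕ) (l : ι → ℝ) {y : ι}
    (h0 : x j ≠ y) (h1 : x (j + 1) ≠ y) (t : ℝ) :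
    linkDeriv x p j (Function.update l y t) = linkDeriv x p j l := by
  simp only [linkDeriv, Function.update_of_ne h0, Function.update_of_ne h1]

theorem linkProd_zero_deriv [DecidableEq ι] (x : ℕ → ι) (p : ℕ → ℝ) {m : ℕ}
    (hinj : ∀ i ≤ m, ∀ j ≤ m, x i = x j → i = j) (hm : 0 < m) (l : ι → ℝ) :
    HasDerivAt (fun t => linkProd x p m 0 (Function.update l (x 0) t)) (linkProd x p m 1 l)
      (l (x 0)) := by
  have hne : ∀ i ≤ m, i ≠ 0 → x i ≠ x 0 := fun i hi h0 h =>
    h0 (hinj i hi 0 (Nat.zero_le _) h)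
  have hrest : ∀ t, ∏ j ∈ Finset.Ico 1 m, linkWeight x p j (Function.update l (x 0) t) =
      ∏ j ∈ Finset.Ico 1 m, linkWeight x p j l := by
    intro t
    refine Finset.prod_congr rfl fun j hj => ?_
    rw [Finset.mem_Ico] at hj
    exact linkWeight_update x p j l (hne j (by omega) (by omega))
      (hne (j + 1) (by omega) (by omega)) t
  have h := (hasDerivAt_linkWeight x p 0 l (hne 1 hm one_ne_zero).symm).mul_const
    (∏ j ∈ Finset.Ico 1 m, linkWeight x p j l)
  simp only [linkProd, Finset.prod_eq_prod_Ico_succ_bot hm, Finset.prod_range_zero,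
    Finset.prod_range_one, one_mul, zero_add, hrest]
  exact h

/-- The variable at `x (i + 1)` enters only link `i`, already differentiated, and link `i + 1`, not
yet differentiated. Differentiating the former restores its weight with a factor `p i`;
differentiating the latter advances the product. -/
theorem linkProd_succ_deriv [DecidableEq ι] (x : ℕ → ι) (p : ℕ → ℝ) {m i : ℕ}
    (hinj : ∀ i ≤ m, ∀ j ≤ m, x i = x j → i = j) (hi : i + 1 < m) (l : ι → ℝ) :
    HasDerivAt (fun t => linkProd x p m (i + 1) (Function.update l (x (i + 1)) t))
      (linkProd x p m (i + 2) l + p i * linkProd x p m i l) (l (x (i + 1))) := by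
  have hne : ∀ j ≤ m, j ≠ i + 1 → x j ≠ x (i + 1) := fun j hj h0 h =>
    h0 (hinj j hj (i + 1) hi.le h)
  have hrest : ∀ t, ∏ j ∈ Finset.Ico (i + 2) m,
      linkWeight x p j (Function.update l (x (i + 1)) t) =
      ∏ j ∈ Finset.Ico (i + 2) m, linkWeight x p j l := by
    intro t
    refine Finset.prod_congr rfl fun j hj => ?_
    rw [Finset.mem_Ico] at hj
    exact linkWeight_update x p j l (hne j (by omega) (by omega))
      (hne (j + 1) (by omega) (by omega)) t
  have hinit : ∀ t, ∏ j ∈ Finset.range i, linkDeriv x p j (Function.update l (x (i + 1)) t) =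
      ∏ j ∈ Finset.range i, linkDeriv x p j l := by
    intro t
    refine Finset.prod_congr rfl fun j hj => ?_
    rw [Finset.mem_range] at hj
    exact linkDeriv_update x p j l (hne j (by omega) (by omega))
      (hne (j + 1) (by omega) (by omega)) t
  have h1 := hasDerivAt_linkWeight x p (i + 1) l (hne (i + 2) (by omega) (by omega)).symm
  have h2 := hasDerivAt_linkDeriv x p i l (hne i (by omega) (by omega))
  have h := ((h2.const_mul (∏ j ∈ Finset.range i, linkDeriv x p j l)).mul
    (h1.mul_const (∏ j ∈ Finset.Ico (i + 2) m, linkWeight x p j l)))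
  simp only [linkProd, Finset.prod_range_succ, Finset.prod_eq_prod_Ico_succ_bot hi,
    Finset.prod_eq_prod_Ico_succ_bot (show i < m by omega), hrest, hinit]
  refine h.congr_deriv ?_
  simp only [Function.update_eq_self]
  ring

variable [Fintype ι] [LinearOrder ι]

/-- Applying the continuant of a tridiagonal operator matrix to a product of link weights
differentiates the links one after the other. -/
theorem diffOp_leadingMinor_mul (α : ι → ℝ) (x : ℕ → ι) (p : ℕ → ℝ) {m : ℕ}
    (hinj : ∀ i ≤ m, ∀ j ≤ m, x i = x j → i = j) {S : (ι → ℝ) → ℂ}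
    (hS : ∀ j < m, ∀ l t, S (Function.update l (x j) t) = S l) {F : (ι → ℝ) → ℂ}
    (hF : ContDiff ℝ ∞ F) {q : MvPolynomial ι ℂ}
    (hq : diffOp q F = fun l => diagFactor α l * (linkProd x p m 0 l * S l))
    (N : ℕ → ℕ → MvPolynomial ι ℂ)
    (hdiag : ∀ i < m, N i i = MvPolynomial.X (x i) - MvPolynomial.C (α (x i) : ℂ))
    (hoff : ∀ i, i + 1 < m → N i (i + 1) * N (i + 1) i = MvPolynomial.C (p i : ℂ))
    (hzero : ∀ i < m, ∀ j < m, i + 2 ≤ j ∨ j + 2 ≤ i → N i j = 0) :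
    ∀ i ≤ m, diffOp (leadingMinor N i * q) F =
      fun l => diagFactor α l * (linkProd x p m i l * S l) := by
  -- Behind the factor `diagFactor`, the operator `∂ - α` acts as `∂`, and `S` is a constant for it.
  -- The end site `x m` is never differentiated, so `S` may depend on it.
  have step : ∀ i < m, ∀ D : (ι → ℝ) → ℂ,
      (∀ l, HasDerivAt (fun t => linkProd x p m i (Function.update l (x i) t)) (D l) (l (x i))) →
      ∀ k : MvPolynomial ι ℂ, diffOp k F =
        (fun l => diagFactor α l * (linkProd x p m i l * S l)) →
      diffOp (N i i * k) F = fun l => diagFactor α l * (D l * S l) := by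
    intro i hi D hD k hk
    rw [hdiag i hi, sub_mul, sub_eq_add_neg, ← neg_mul, ← MvPolynomial.C_neg, diffOp_add,
      diffOp_C_mul, diffOp_X_mul hF, hk]
    funext l
    have h := (hasDerivAt_diagFactor α l (x i)).mul ((hD l).mul_const (S l))
    simp only [Function.update_eq_self] at h
    have h' : partialDeriv (x i) (fun l => diagFactor α l * (linkProd x p m i l * S l)) l =
        α (x i) * diagFactor α l * (linkProd x p m i l * S l) + diagFactor α l * (D l * S l) := by
      simp only [partialDeriv, hS i hi]
      exact h.deriv
    rw [Pi.add_apply, h']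
    simp only [Pi.smul_apply, smul_eq_mul]
    ring
  intro i
  induction i using Nat.twoStepInduction with
  | zero =>
    intro _
    rw [leadingMinor_zero, one_mul, hq]
  | one =>
    intro hm
    rw [leadingMinor_one]
    exact step 0 hm _ (linkProd_zero_deriv x p hinj hm) q hq
  | more i ih0 ih1 =>
    intro hm
    -- The subtracted term of the continuant recurrence cancels the term `p i * linkProd x p m i` of
    -- the product rule.
    rw [leadingMinor_add_two N i (fun j hj => hzero _ (by omega) _ (by omega) (by omega))
      (fun j hj => hzero _ (by omega) _ (by omega) (by omega)), hoff i (by omega), sub_mul,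
      mul_assoc, mul_assoc, sub_eq_add_neg, ← neg_mul, ← MvPolynomial.C_neg, diffOp_add,
      diffOp_C_mul, ih0 (by omega),
      step (i + 1) (by omega) _ (linkProd_succ_deriv x p hinj (by omega)) _ (ih1 (by omega))]
    funext l
    simp only [Pi.add_apply, Pi.smul_apply, smul_eq_mul]
    ring

end Chain

end LocalTimes

/-! ### Factorization of the angular integral -/

namespace LocalTimes

open MeasureTheory

theorem sum_sum_tridiagonal (n : ℕ) (M : ℕ → ℕ → ℂ)
    (hM : ∀ i j, i + 2 ≤ j ∨ j + 2 ≤ i → M i j = 0) :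
    ∑ i ∈ Finset.range (n + 1), ∑ j ∈ Finset.range (n + 1), M i j =
      ∑ i ∈ Finset.range (n + 1), M i i + ∑ i ∈ Finset.range n, (M i (i + 1) + M (i + 1) i) := by
  induction n with
  | zero => simp
  | succ n ih =>
    have h1 : ∑ i ∈ Finset.range (n + 1), M i (n + 1) = M n (n + 1) := by
      rw [Finset.sum_range_succ, Finset.sum_eq_zero, zero_add]
      intro i hi
      exact hM _ _ (by have := Finset.mem_range.mp hi; omega)
    have h2 : ∑ j ∈ Finset.range (n + 1), M (n + 1) j = M (n + 1) n := by
      rw [Finset.sum_range_succ, Finset.sum_eq_zero, zero_add]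
      intro i hi
      exact hM _ _ (by have := Finset.mem_range.mp hi; omega)
    rw [Finset.sum_range_succ]
    simp_rw [Finset.sum_range_succ _ (n + 1)]
    rw [Finset.sum_add_distrib, ih, h1, h2,
      Finset.sum_range_succ (fun i => M i (i + 1) + M (i + 1) i) n]
    ring

theorem intervalIntegral_comp_sub_of_periodic {f : ℝ → ℂ} {T : ℝ}
    (hf : Function.Periodic f T) (u : ℝ) :
    ∫ t in (0 : ℝ)..T, f (t - u) = ∫ t in (0 : ℝ)..T, f t := by
  rw [intervalIntegral.integral_comp_sub_right]
  have := hf.intervalIntegral_add_eq (0 - u) 0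
  rw [zero_add] at this
  rw [← this]
  congr 1
  ring

/-- The integral of a product of periodic functions of successive angle differences. -/
theorem integral_prod_angle_differences (n : ℕ) (f : ℕ → ℝ → ℂ) (hc : ∀ i, Continuous (f i))
    (hp : ∀ i, Function.Periodic (f i) (2 * Real.pi)) :
    ∫ θ : Fin (n + 1) → ℝ, ∏ i : Fin n, f i (θ i.castSucc - θ i.succ)
        ∂(Measure.pi fun _ => volume.restrict (Set.Icc 0 (2 * Real.pi))) =
      2 * Real.pi * ∏ i ∈ Finset.range n, ∫ t in (0 : ℝ)..(2 * Real.pi), f i t := by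
  have hpi : (0 : ℝ) ≤ 2 * Real.pi := by positivity
  set μ : Measure ℝ := volume.restrict (Set.Icc 0 (2 * Real.pi)) with hμ
  have hone : ∀ g : ℝ → ℂ, ∫ t, g t ∂μ = ∫ t in (0 : ℝ)..(2 * Real.pi), g t := by
    intro g
    rw [intervalIntegral.integral_of_le hpi, ← integral_Icc_eq_integral_Ioc]
  have hfin : IsFiniteMeasure μ := ⟨by
    rw [hμ, Measure.restrict_apply_univ, Real.volume_Icc]
    exact ENNReal.ofReal_lt_top⟩
  induction n generalizing f with
  | zero =>
    have hvol : μ.real Set.univ = 2 * Real.pi := by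
      rw [hμ, measureReal_restrict_apply_univ, Real.volume_real_Icc]
      simp [hpi]
    simp [Measure.real, Measure.pi_univ] at hvol ⊢
    rw [hvol]
    push_cast
    rfl
  | succ n ih =>
    -- Split off the first angle: it occurs in one factor only, and by periodicity its integral does
    -- not depend on the next angle.
    rw [← ((measurePreserving_piFinSuccAbove (fun _ : Fin (n + 2) => μ) 0).symm).integral_comp']
    simp only [MeasurableEquiv.piFinSuccAbove_symm_apply, Fin.insertNthEquiv,
      Fin.prod_univ_succ, Fin.insertNth_zero, Equiv.coe_fn_mk, Fin.zero_succAbove,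
      Fin.castSucc_zero, Fin.castSucc_succ, Fin.cons_succ, Fin.cons_zero, cast_eq]
    rw [integral_prod_symm]
    · have hinner : ∀ y : Fin (n + 1) → ℝ,
          ∫ t, f 0 (t - y 0) * ∏ i : Fin n, f (i + 1) (y i.castSucc - y i.succ) ∂μ =
          (∫ t in (0 : ℝ)..(2 * Real.pi), f 0 t) *
            ∏ i : Fin n, f (i + 1) (y i.castSucc - y i.succ) := by
        intro y
        rw [integral_mul_const, hone, intervalIntegral_comp_sub_of_periodic (hp 0)]
      simp only [Fin.val_zero, Fin.val_succ]
      rw [integral_congr_ae (Filter.Eventually.of_forall hinner), integral_const_mul,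
        ih (fun i => f (i + 1)) (fun i => hc _) (fun i => hp _), Finset.prod_range_succ']
      ring
    · rw [hμ, ← Measure.restrict_pi_pi, Measure.prod_restrict]
      refine ContinuousOn.integrableOn_compact
        (isCompact_Icc.prod (isCompact_univ_pi fun _ => isCompact_Icc)) ?_
      fun_prop

theorem prod_Ico_eq_prod_range {c d : ℤ} {n : ℕ} (hn : c + n = d) (f : ℤ → ℂ) :
    ∏ x ∈ Finset.Ico c d, f x = ∏ i ∈ Finset.range n, f (c + i) := by
  symm
  refine Finset.prod_nbij' (fun i => c + (i : ℕ)) (fun x => (x - c).toNat) ?_ ?_ ?_ ?_ ?_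
  · intro i hi
    rw [Finset.mem_range] at hi
    rw [Finset.mem_Ico]
    omega
  · intro x hx
    rw [Finset.mem_Ico] at hx
    rw [Finset.mem_range]
    omega
  · intro i _
    omega
  · intro x hx
    rw [Finset.mem_Ico] at hx
    omega
  · intro i _
    rfl

theorem thetaIntegral_eq {A : Matrix ℤ ℤ ℝ} (htri : IsTridiagonal A) {c d : ℤ} (hcd : c ≤ d)
    (r : ℤ → Finset.Icc c d) (hr : ∀ x ∈ Finset.Icc c d, (r x : ℤ) = x)
    (l : Finset.Icc c d → ℝ) (hl : ∀ x, 0 < l x) :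
    thetaIntegral A (Finset.Icc c d) l =
      Complex.exp (∑ x : Finset.Icc c d, (A x x : ℂ) * (l x : ℂ)) *
        ∏ x ∈ Finset.Ico c d,
          besselSeries 0 (A x (x + 1) * A (x + 1) x * (l (r x) * l (r (x + 1)))) := by
  obtain ⟨n, hn⟩ : ∃ n : ℕ, c + n = d := ⟨(d - c).toNat, by omega⟩
  have hpi : (Real.pi : ℂ) ≠ 0 := by exact_mod_cast Real.pi_ne_zero
  have hri : ∀ i : Fin (n + 1), (r (c + (i : ℕ)) : ℤ) = c + (i : ℕ) := fun i =>
    hr _ (by rw [Finset.mem_Icc]; omega)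
  have hbij : Function.Bijective fun i : Fin (n + 1) => r (c + (i : ℕ)) := by
    refine ⟨fun i j hij => ?_, fun x => ?_⟩
    · have := congrArg (fun z : Finset.Icc c d => (z : ℤ)) hij
      simp only [hri] at this
      omega
    · have hx := Finset.mem_Icc.mp x.2
      refine ⟨⟨((x : ℤ) - c).toNat, by omega⟩, Subtype.ext ?_⟩
      simp only
      rw [Int.toNat_of_nonneg (by omega), add_sub_cancel, hr _ x.2]
  let e : Fin (n + 1) ≃ Finset.Icc c d := Equiv.ofBijective _ hbij
  have he : ∀ i, e i = r (c + (i : ℕ)) := fun i => rfl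
  set s : ℕ → ℝ := fun i => Real.sqrt (l (r (c + i))) with hs
  have hss : ∀ i, (s i : ℂ) * s i = l (r (c + i)) := fun i => by
    rw [← Complex.ofReal_mul, Real.mul_self_sqrt (hl _).le]
  set f : ℕ → ℝ → ℂ := fun i φ => Complex.exp (((s i * s (i + 1) : ℝ) : ℂ) *
    ((A (c + i) (c + i + 1) : ℂ) * Complex.exp (Complex.I * φ) +
      (A (c + i + 1) (c + i) : ℂ) * Complex.exp (-(Complex.I * φ)))) with hf
  have hfc : ∀ i, Continuous (f i) := fun i => by
    simp only [hf]
    fun_prop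
  have hfp : ∀ i, Function.Periodic (f i) (2 * Real.pi) := fun i φ => by
    have h1 : Complex.exp (Complex.I * ((φ + 2 * Real.pi : ℝ) : ℂ)) =
        Complex.exp (Complex.I * φ) := by
      have := Complex.exp_periodic (Complex.I * φ)
      rw [← this]
      congr 1
      push_cast
      ring
    simp only [hf, Complex.exp_neg, h1]
  have hfint : ∀ i, ∫ t in (0 : ℝ)..(2 * Real.pi), f i t = 2 * Real.pi *
      besselSeries 0 (A (c + i) (c + i + 1) * A (c + i + 1) (c + i) *
        (l (r (c + i)) * l (r (c + i + 1)))) := by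
    intro i
    have h := gFun_eq_besselSeries A (show c + i ≠ c + i + 1 by omega) (s i * s (i + 1))
    have hsq : (s i * s (i + 1)) ^ 2 = l (r (c + i)) * l (r (c + i + 1)) := by
      rw [mul_pow]
      simp only [hs]
      rw [Real.sq_sqrt (hl _).le, Real.sq_sqrt (hl _).le]
      push_cast
      rw [← add_assoc]
    rw [hsq] at h
    rw [← h, gFun, intervalIntegral.integral_mul_const]
    simp only [offDiagPart, Matrix.of_apply, if_neg (show c + (i : ℤ) ≠ c + i + 1 by omega),
      if_neg (show c + (i : ℤ) + 1 ≠ c + i by omega), hf]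
    field_simp
  have hexp : ∀ θ : Fin (n + 1) → ℝ,
      Complex.exp (∑ x : Finset.Icc c d, ∑ y : Finset.Icc c d,
        (A x y : ℂ) * (Real.sqrt (l x) : ℂ) * (Real.sqrt (l y) : ℂ)
          * Complex.exp (Complex.I * ((θ (e.symm x) : ℂ) - (θ (e.symm y) : ℂ)))) =
      Complex.exp (∑ x : Finset.Icc c d, (A x x : ℂ) * (l x : ℂ)) *
        ∏ i : Fin n, f i (θ i.castSucc - θ i.succ) := by
    intro θ
    -- The value `0` beyond `n` is never used; the extension only allows sums over ranges in `ℕ`.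
    set Θ : ℕ → ℝ := fun i => if h : i < n + 1 then θ ⟨i, h⟩ else 0 with hΘ
    have hΘi : ∀ i : Fin (n + 1), θ i = Θ i := fun i => by
      simp only [hΘ]
      rw [dif_pos i.2]
    set M : ℕ → ℕ → ℂ := fun i j => (A (c + i) (c + j) : ℂ) * s i * s j
      * Complex.exp (Complex.I * ((Θ i : ℂ) - (Θ j : ℂ))) with hM
    have hM0 : ∀ i j, i + 2 ≤ j ∨ j + 2 ≤ i → M i j = 0 := fun i j hij => by
      have : A (c + i) (c + j) = 0 := htri _ _ (le_abs.mpr (by omega))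
      simp [hM, this]
    have h1 : ∑ x : Finset.Icc c d, ∑ y : Finset.Icc c d,
        (A x y : ℂ) * (Real.sqrt (l x) : ℂ) * (Real.sqrt (l y) : ℂ)
          * Complex.exp (Complex.I * ((θ (e.symm x) : ℂ) - (θ (e.symm y) : ℂ))) =
        ∑ i ∈ Finset.range (n + 1), ∑ j ∈ Finset.range (n + 1), M i j := by
      rw [← e.sum_comp, ← Fin.sum_univ_eq_sum_range]
      refine Finset.sum_congr rfl fun i _ => ?_
      rw [← e.sum_comp, ← Fin.sum_univ_eq_sum_range]
      refine Finset.sum_congr rfl fun j _ => ?_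
      rw [Equiv.symm_apply_apply, Equiv.symm_apply_apply, he, he, hri, hri, hΘi, hΘi]
    have h2 : ∑ x : Finset.Icc c d, (A x x : ℂ) * (l x : ℂ) =
        ∑ i ∈ Finset.range (n + 1), M i i := by
      rw [← e.sum_comp, ← Fin.sum_univ_eq_sum_range]
      refine Finset.sum_congr rfl fun i _ => ?_
      simp only [hM, sub_self, mul_zero, Complex.exp_zero, mul_one, mul_assoc, hss]
      rw [he, hri]
    rw [h1, h2, sum_sum_tridiagonal n M hM0, Complex.exp_add,
      Complex.exp_sum (Finset.range n), ← Fin.prod_univ_eq_prod_range]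
    congr 1
    refine Finset.prod_congr rfl fun i _ => ?_
    rw [hΘi, hΘi]
    simp only [hf, hM, Fin.val_castSucc, Fin.val_succ]
    congr 1
    have h3 : Complex.I * ((Θ (i + 1) : ℂ) - Θ i) =
        -(Complex.I * ((Θ i - Θ (i + 1) : ℝ) : ℂ)) := by push_cast; ring
    have h4 : Complex.I * ((Θ i : ℂ) - Θ (i + 1)) =
        Complex.I * ((Θ i - Θ (i + 1) : ℝ) : ℂ) := by push_cast; ring
    rw [h3, h4]
    push_cast
    rw [← add_assoc]
    ring
  rw [thetaIntegral, ← Set.pi_univ_Icc, volume_pi, Measure.restrict_pi_pi,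
    ← (measurePreserving_piCongrLeft
      (fun _ : Finset.Icc c d => volume.restrict (Set.Icc 0 (2 * Real.pi))) e).integral_comp']
  have hcongr : ∀ θ : Fin (n + 1) → ℝ, ∀ x : Finset.Icc c d,
      (MeasurableEquiv.piCongrLeft (fun _ : Finset.Icc c d => ℝ) e) θ x = θ (e.symm x) := by
    intro θ x
    obtain ⟨i, rfl⟩ := e.surjective x
    rw [MeasurableEquiv.coe_piCongrLeft, Equiv.piCongrLeft_apply_apply, Equiv.symm_apply_apply]
  simp only [hcongr, hexp]
  rw [integral_mul_const, integral_const_mul, integral_prod_angle_differences n f hfc hfp,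
    prod_Ico_eq_prod_range hn]
  simp only [hfint, Finset.prod_mul_distrib, Finset.prod_const, Finset.card_range,
    Finset.card_univ, Fintype.card_coe, Int.card_Icc]
  -- Of the `n + 1` normalizing factors `1/(2π)`, the links use `n` and the free overall rotation
  -- uses one.
  rw [show (d + 1 - c).toNat = n + 1 by omega, one_div, inv_pow, mul_pow, pow_succ, pow_succ]
  field_simp

end LocalTimes

/-! ### Assembling the density -/

namespace LocalTimes

open scoped ContDiff

theorem deriv_gFun_sqrt_mul {Λ : Type*} [DecidableEq Λ] (A : Matrix Λ Λ ℝ) {x y : Λ}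
    (hxy : x ≠ y) {s m : ℝ} (hs : 0 < s) (hm : 0 < m) :
    deriv (fun t : ℝ => gFun A x y (Real.sqrt (t * s))) m =
      (A x y * A y x : ℝ) * s * besselSeries 1 (A x y * A y x * (m * s)) := by
  have h := hasDerivAt_besselSeries_mul 0 (A x y * A y x * s) m
  have heq : (fun t : ℝ => gFun A x y (Real.sqrt (t * s))) =ᶠ[nhds m]
      fun t => besselSeries 0 (A x y * A y x * s * t) := by
    filter_upwards [lt_mem_nhds hm] with t ht
    rw [gFun_eq_besselSeries A hxy, Real.sq_sqrt (by positivity)]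
    congr 1
    ring
  rw [heq.deriv_eq, h.deriv]
  push_cast
  congr 2
  ring

theorem prod_Ico_reflect {b d : ℤ} (hbd : b ≤ d) (f : ℤ → ℂ) :
    ∏ x ∈ Finset.Ico b d, f x = ∏ j ∈ Finset.range (d - b).toNat, f (d - j - 1) := by
  symm
  refine Finset.prod_nbij' (fun i => d - (i : ℕ) - 1) (fun x => (d - x - 1).toNat) ?_ ?_ ?_ ?_ ?_
  · intro i hi
    rw [Finset.mem_range] at hi
    rw [Finset.mem_Ico]
    omega
  · intro x hx
    rw [Finset.mem_Ico] at hx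
    rw [Finset.mem_range]
    omega
  · intro i _
    omega
  · intro x hx
    rw [Finset.mem_Ico] at hx
    omega
  · intro i _
    rfl

theorem prod_Ico_int_split (f : ℤ → ℂ) {a b c : ℤ} (hab : a ≤ b) (hbc : b ≤ c) :
    ∏ x ∈ Finset.Ico a c, f x = (∏ x ∈ Finset.Ico a b, f x) * ∏ x ∈ Finset.Ico b c, f x := by
  rw [← Finset.Ico_union_Ico_eq_Ico hab hbc,
    Finset.prod_union (Finset.Ico_disjoint_Ico_consecutive a b c)]

/-- The density of the local times on an interval, as a product over the links. -/
theorem localTimeDensity_eq_linkProd {A : Matrix ℤ ℤ ℝ} (htri : IsTridiagonal A)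
    {c d a b : ℤ} (hca : c ≤ a) (hab : a ≤ b) (hbd : b ≤ d)
    (r : ℤ → Finset.Icc c d) (hr : ∀ x ∈ Finset.Icc c d, (r x : ℤ) = x)
    (l : Finset.Icc c d → ℝ) (hl : ∀ x, 0 < l x) :
    localTimeDensity A (Finset.Icc c d) (r a) (r b) l =
      diagFactor (fun x : Finset.Icc c d => A x x) l
        * linkProd (fun j => r (c + j)) (fun j => A (c + j) (c + j + 1) * A (c + j + 1) (c + j))
            (a - c).toNat (a - c).toNat l
        * (∏ x ∈ Finset.Ico a b, (A x (x + 1) : ℂ)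
            * besselSeries 0 (A x (x + 1) * A (x + 1) x * (l (r x) * l (r (x + 1)))))
        * linkProd (fun j => r (d - j))
            (fun j => A (d - j - 1) (d - j) * A (d - j) (d - j - 1))
            (d - b).toNat (d - b).toNat l := by
  set W : ℤ → (Finset.Icc c d → ℝ) → ℂ := fun x l =>
    besselSeries 0 (A x (x + 1) * A (x + 1) x * (l (r x) * l (r (x + 1)))) with hW
  set α : Finset.Icc c d → ℝ := fun x => A x x with hα
  set F : (Finset.Icc c d → ℝ) → ℂ := fun l =>
    diagFactor α l * ∏ x ∈ Finset.Ico c d, W x l with hFdef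
  have hF : ContDiff ℝ ∞ F := by
    refine ContDiff.mul ?_ (contDiff_prod fun x _ => ?_)
    · refine ContDiff.cexp (ContDiff.sum fun x _ => contDiff_const.mul ?_)
      exact Complex.ofRealCLM.contDiff.comp (contDiff_apply ℝ ℝ x)
    · exact (contDiff_besselSeries 0).comp
        (contDiff_const.mul ((contDiff_apply ℝ ℝ _).mul (contDiff_apply ℝ ℝ _)))
  have hrne : ∀ x ∈ Finset.Icc c d, ∀ y ∈ Finset.Icc c d, x ≠ y → r x ≠ r y := by
    intro x hx y hy hxy h
    have := congrArg Subtype.val h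
    rw [hr x hx, hr y hy] at this
    exact hxy this
  set M : Matrix (Finset.Icc c d) (Finset.Icc c d) (MvPolynomial (Finset.Icc c d) ℂ) :=
    Matrix.of fun x y => -(MvPolynomial.C ((A x y : ℝ) : ℂ)) +
      if x = y then MvPolynomial.X x else 0 with hMdef
  have hMdiag : ∀ x, M x x = MvPolynomial.X x - MvPolynomial.C (α x : ℂ) := by
    intro x
    simp only [hMdef, Matrix.of_apply, if_true, hα]
    ring
  have hMoff : ∀ x ∈ Finset.Icc c d, ∀ y ∈ Finset.Icc c d, x ≠ y →
      M (r x) (r y) = -MvPolynomial.C ((A x y : ℝ) : ℂ) := by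
    intro x hx y hy hxy
    simp only [hMdef, Matrix.of_apply, if_neg (hrne x hx y hy hxy), add_zero, hr x hx, hr y hy]
  have hMzero : ∀ x y : Finset.Icc c d, 2 ≤ |(x : ℤ) - y| → M x y = 0 := by
    intro x y hxy
    have hne : x ≠ y := by
      rintro rfl
      simp at hxy
    simp [hMdef, htri _ _ hxy, hne]
  have hsymbol : cofactorSymbol A (Finset.Icc c d) (r a) (r b) =
      leadingMinor (fun i j => M (r (c + i)) (r (c + j))) (a - c).toNat
        * (∏ x ∈ Finset.Ico a b, -M (r x) (r (x + 1)))
        * leadingMinor (fun i j => M (r (d - i)) (r (d - j))) (d - b).toNat := by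
    rw [← cofactorDet_of_tridiagonal r hr hca hab hbd M hMzero, cofactorSymbol]
  have hB : ∏ x ∈ Finset.Ico a b, -M (r x) (r (x + 1)) =
      MvPolynomial.C (∏ x ∈ Finset.Ico a b, (A x (x + 1) : ℂ)) := by
    rw [map_prod]
    refine Finset.prod_congr rfl fun x hx => ?_
    rw [Finset.mem_Ico] at hx
    rw [hMoff x (by rw [Finset.mem_Icc]; omega) (x + 1) (by rw [Finset.mem_Icc]; omega) (by omega),
      neg_neg]
  have hWupdate : ∀ x y : ℤ, x ∈ Finset.Icc c d → x + 1 ∈ Finset.Icc c d → y ∈ Finset.Icc c d →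
      y ≠ x → y ≠ x + 1 → ∀ l t, W x (Function.update l (r y) t) = W x l := by
    intro x y hx hx1 hy h0 h1 l t
    simp only [hW, Function.update_of_ne (hrne x hx y hy h0.symm),
      Function.update_of_ne (hrne _ hx1 y hy h1.symm)]
  -- The chain runs from `d` down to `b`; the links to the left of `b` are inert.
  have hright := diffOp_leadingMinor_mul α (fun j => r (d - j))
    (fun j => A (d - j - 1) (d - j) * A (d - j) (d - j - 1)) (m := (d - b).toNat)
    (fun i hi j hj hij => by
      by_contra h
      exact hrne (d - i) (by rw [Finset.mem_Icc]; omega) (d - j) (by rw [Finset.mem_Icc]; omega)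
        (by omega) hij)
    (S := fun l => ∏ x ∈ Finset.Ico c b, W x l)
    (fun j hj l t => Finset.prod_congr rfl fun x hx => by
      rw [Finset.mem_Ico] at hx
      exact hWupdate x (d - j) (by rw [Finset.mem_Icc]; omega) (by rw [Finset.mem_Icc]; omega)
        (by rw [Finset.mem_Icc]; omega) (by omega) (by omega) l t)
    hF (q := 1)
    (by
      rw [diffOp_one]
      funext l
      simp only [hFdef, linkProd, Finset.prod_range_zero, one_mul, Nat.Ico_zero_eq_range]
      rw [prod_Ico_int_split (fun x => W x l) (hca.trans hab) hbd, prod_Ico_reflect hbd, mul_comm (∏ x ∈ Finset.Ico c b, W x l)]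
      congr 2
      refine Finset.prod_congr rfl fun j _ => ?_
      simp only [hW, linkWeight]
      push_cast
      rw [sub_add_cancel, ← sub_sub, mul_comm (l (r (d - j - 1)))])
    (fun i j => M (r (d - i)) (r (d - j)))
    (fun i _ => hMdiag _)
    (fun i hi => by
      rw [hMoff _ (by rw [Finset.mem_Icc]; omega) _ (by rw [Finset.mem_Icc]; omega) (by omega),
        hMoff _ (by rw [Finset.mem_Icc]; omega) _ (by rw [Finset.mem_Icc]; omega) (by omega),
        neg_mul_neg, ← MvPolynomial.C_mul]
      push_cast
      rw [← sub_sub, mul_comm])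
    (fun i hi j hj hij => hMzero _ _ (by
      rw [hr _ (by rw [Finset.mem_Icc]; omega), hr _ (by rw [Finset.mem_Icc]; omega), le_abs]
      omega))
    _ le_rfl
  rw [mul_one] at hright
  -- The chain from `c` up to `a` acts on the output of `hright`. The inert factor now holds the
  -- middle weights and the differentiated right links, none of which involves a site below `a`.
  have hleft := diffOp_leadingMinor_mul α (fun j => r (c + j))
    (fun j => A (c + j) (c + j + 1) * A (c + j + 1) (c + j)) (m := (a - c).toNat)
    (fun i hi j hj hij => by
      by_contra h
      exact hrne (c + i) (by rw [Finset.mem_Icc]; omega) (c + j) (by rw [Finset.mem_Icc]; omega)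
        (by omega) hij)
    (S := fun l => (∏ x ∈ Finset.Ico a b, W x l) *
      linkProd (fun j => r (d - j)) (fun j => A (d - j - 1) (d - j) * A (d - j) (d - j - 1))
        (d - b).toNat (d - b).toNat l)
    (fun j hj l t => by
      congr 1
      · refine Finset.prod_congr rfl fun x hx => ?_
        rw [Finset.mem_Ico] at hx
        exact hWupdate x (c + j) (by rw [Finset.mem_Icc]; omega) (by rw [Finset.mem_Icc]; omega)
          (by rw [Finset.mem_Icc]; omega) (by omega) (by omega) l t
      · simp only [linkProd, Finset.Ico_self, Finset.prod_empty, mul_one]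
        refine Finset.prod_congr rfl fun i hi => ?_
        rw [Finset.mem_range] at hi
        have h0 : r (d - i) ≠ r (c + j) := hrne _ (by rw [Finset.mem_Icc]; omega) _
          (by rw [Finset.mem_Icc]; omega) (by omega)
        have h1 : r (d - (i + 1 : ℕ)) ≠ r (c + j) := hrne _ (by rw [Finset.mem_Icc]; omega) _
          (by rw [Finset.mem_Icc]; omega) (by omega)
        exact linkDeriv_update _ _ i l h0 h1 t)
    hF (q := leadingMinor (fun i j => M (r (d - i)) (r (d - j))) (d - b).toNat)
    (by
      rw [hright]
      funext l
      rw [prod_Ico_int_split _ hca hab,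
        prod_Ico_eq_prod_range (n := (a - c).toNat) (by omega)]
      have : linkProd (fun j : ℕ => r (c + j))
          (fun j => A (c + j) (c + j + 1) * A (c + j + 1) (c + j)) (a - c).toNat 0 l =
          ∏ i ∈ Finset.range (a - c).toNat, W (c + i) l := by
        simp only [linkProd, Finset.prod_range_zero, one_mul, Nat.Ico_zero_eq_range]
        refine Finset.prod_congr rfl fun j _ => ?_
        simp only [hW, linkWeight]
        push_cast
        rw [← add_assoc]
      rw [this]
      ring)
    (fun i j => M (r (c + i)) (r (c + j)))
    (fun i _ => hMdiag _)
    (fun i hi => by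
      rw [hMoff _ (by rw [Finset.mem_Icc]; omega) _ (by rw [Finset.mem_Icc]; omega) (by omega),
        hMoff _ (by rw [Finset.mem_Icc]; omega) _ (by rw [Finset.mem_Icc]; omega) (by omega),
        neg_mul_neg, ← MvPolynomial.C_mul]
      push_cast
      rw [← add_assoc])
    (fun i hi j hj hij => hMzero _ _ (by
      rw [hr _ (by rw [Finset.mem_Icc]; omega), hr _ (by rw [Finset.mem_Icc]; omega), le_abs]
      omega))
    _ le_rfl
  have hθ : ∀ l : Finset.Icc c d → ℝ, (∀ x, 0 < l x) →
      thetaIntegral A (Finset.Icc c d) l = F l := fun l hl =>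
    thetaIntegral_eq htri (by omega) r hr l hl
  rw [localTimeDensity, diffOp_congr_pos hθ _ l hl, hsymbol, hB,
    mul_comm (leadingMinor _ (a - c).toNat), mul_assoc, diffOp_C_mul, hleft]
  simp only [Pi.smul_apply, smul_eq_mul, Finset.prod_mul_distrib]
  ring

end LocalTimes

theorem propositionA1 (A : Matrix ℤ ℤ ℝ)
    (hA : LocalTimes.IsConservativeGenerator A) (htri : LocalTimes.IsTridiagonal A)
    (R : Finset ℤ) (hR : (R : Set ℤ).OrdConnected)
    (a b : ℤ) (ha : a ∈ R) (hb : b ∈ R) (hab : a ≤ b)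
    (l : ℤ → ℝ) (hl : ∀ x ∈ R, 0 < l x) :
    LocalTimes.localTimeDensity A R ⟨a, ha⟩ ⟨b, hb⟩ (fun x : R => l x) =
      Complex.exp (∑ x ∈ R, (A x x : ℂ) * (l x : ℂ))
      * (∏ x ∈ R with x < a,
          deriv (fun t : ℝ => LocalTimes.gFun A x (x + 1) (Real.sqrt (t * l (x + 1)))) (l x))
      * (∏ x ∈ Finset.Ico a b,
          (LocalTimes.offDiagPart A x (x + 1) : ℂ)
            * LocalTimes.gFun A x (x + 1) (Real.sqrt (l x * l (x + 1))))
      * (∏ y ∈ R with b < y,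
          deriv (fun t : ℝ => LocalTimes.gFun A (y - 1) y (Real.sqrt (l (y - 1) * t))) (l y)) := by
  obtain ⟨c, d, rfl⟩ : ∃ c d, R = Finset.Icc c d := by
    have hne : R.Nonempty := ⟨a, ha⟩
    refine ⟨R.min' hne, R.max' hne, Finset.Subset.antisymm (fun x hx => ?_) fun x hx => ?_⟩
    · exact Finset.mem_Icc.mpr ⟨R.min'_le x hx, R.le_max' x hx⟩
    · exact hR.out (R.min'_mem hne) (R.max'_mem hne) (Finset.mem_Icc.mp hx)
  obtain ⟨hca, -⟩ := Finset.mem_Icc.mp ha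
  obtain ⟨-, hbd⟩ := Finset.mem_Icc.mp hb
  -- The value outside the interval is arbitrary.
  let r : ℤ → Finset.Icc c d := fun x => if h : x ∈ Finset.Icc c d then ⟨x, h⟩ else ⟨a, ha⟩
  have hr : ∀ x ∈ Finset.Icc c d, (r x : ℤ) = x := fun x hx => by simp only [r, dif_pos hx]
  have hra : (⟨a, ha⟩ : Finset.Icc c d) = r a := Subtype.ext (hr a ha).symm
  have hrb : (⟨b, hb⟩ : Finset.Icc c d) = r b := Subtype.ext (hr b hb).symm
  rw [hra, hrb, LocalTimes.localTimeDensity_eq_linkProd htri hca hab hbd r hr _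
    fun x => hl x x.2]
  congr 1
  · congr 1
    · congr 1
      · rw [LocalTimes.diagFactor, ← Finset.sum_coe_sort (Finset.Icc c d)]
      · have hset : {x ∈ Finset.Icc c d | x < a} = Finset.Ico c a := by
          ext x
          simp only [Finset.mem_filter, Finset.mem_Icc, Finset.mem_Ico]
          omega
        rw [hset, LocalTimes.prod_Ico_eq_prod_range (n := (a - c).toNat) (by omega)]
        simp only [LocalTimes.linkProd, Finset.Ico_self, Finset.prod_empty, mul_one]
        refine Finset.prod_congr rfl fun j hj => ?_
        rw [Finset.mem_range] at hj
        have h0 : c + (j : ℤ) ∈ Finset.Icc c d := by rw [Finset.mem_Icc]; omega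
        have h1 : c + (j : ℤ) + 1 ∈ Finset.Icc c d := by rw [Finset.mem_Icc]; omega
        rw [LocalTimes.deriv_gFun_sqrt_mul A (by omega) (hl _ h1) (hl _ h0), LocalTimes.linkDeriv]
        push_cast
        rw [← add_assoc, hr _ h0, hr _ h1]
    · refine Finset.prod_congr rfl fun x hx => ?_
      rw [Finset.mem_Ico] at hx
      have h0 : x ∈ Finset.Icc c d := by rw [Finset.mem_Icc]; omega
      have h1 : x + 1 ∈ Finset.Icc c d := by rw [Finset.mem_Icc]; omega
      have hpos : 0 ≤ l x * l (x + 1) := (mul_pos (hl _ h0) (hl _ h1)).le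
      rw [LocalTimes.gFun_eq_besselSeries A (by omega), Real.sq_sqrt hpos, hr _ h0, hr _ h1,
        LocalTimes.offDiagPart, Matrix.of_apply, if_neg (by omega)]
  -- Each site `y > b` is matched with the link `(y - 1, y)`, indexed by its left end.
  · have hprod : ∀ f : ℤ → ℂ, ∏ y ∈ Finset.Icc c d with b < y, f y =
        ∏ x ∈ Finset.Ico b d, f (x + 1) := by
      intro f
      rw [Finset.prod_Ico_add']
      refine Finset.prod_congr ?_ fun _ _ => rfl
      ext x
      simp only [Finset.mem_filter, Finset.mem_Icc, Finset.mem_Ico]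
      omega
    rw [hprod, LocalTimes.prod_Ico_reflect hbd]
    simp only [LocalTimes.linkProd, Finset.Ico_self, Finset.prod_empty, mul_one]
    refine Finset.prod_congr rfl fun j hj => ?_
    rw [Finset.mem_range] at hj
    have h0 : d - (j : ℤ) ∈ Finset.Icc c d := by rw [Finset.mem_Icc]; omega
    have h1 : d - (j : ℤ) - 1 ∈ Finset.Icc c d := by rw [Finset.mem_Icc]; omega
    have hcomm : ∀ t : ℝ, l (d - j - 1) * t = t * l (d - j - 1) := fun t => mul_comm _ _
    simp only [sub_add_cancel, hcomm]
    rw [LocalTimes.deriv_gFun_sqrt_mul A (by omega) (hl _ h1) (hl _ h0), LocalTimes.linkDeriv]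
    push_cast
    rw [← sub_sub, hr _ h0, hr _ h1]
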